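/- Write $L^2(0,\infty)$ and $L^2(\mathbb R)$ for the complex Hilbert spaces, $\|\cdot\|$ for their norms, and $\widehat v(\xi)=(2\pi)^{-1/2}\int_{\mathbb R}e^{-i\xi t}v(t)\,dt$ for the Fourier transform. Let $L\colon L^2(0,\infty)\to L^2(0,\infty)$, $(Lf)(x)=\int_0^\infty e^{-x\tau}f(\tau)\,d\tau$, be the (bounded) Laplace transform, let $V\colon L^2(0,\infty)\to L^2(\mathbb R)$, $(Vf)(u)=e^{u/2}f(e^u)$, put $\overline L=L/\sqrt{\pi e}$ (the spectrum of $\overline L^*\overline L$ lies in $[0,e^{-1}]$), and for $p>0$ put $f_p(t)=(-\ln t)^{-p}$ for $0<t<1$, $f_p(0)=0$. Let $s>0$ and let $\varphi\in L^1(\mathbb R)$ satisfy $\int\varphi=1$, where $\widehat\varphi$ is real-valued, $\widehat\varphi(\xi)<1/\sqrt{2\pi}$ for all $\xi\neq0$, $\widehat\varphi(\xi)$ is nonincreasing as a function of $|\xi|$, and $|1-\sqrt{2\pi}\,\widehat\varphi(\xi)|\sim|\xi|^s$ as $\xi\to0$. For $\beta>0$ let $\varphi_\beta(t)=\beta^{-1}\varphi(t/\beta)$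 and let $C_\beta v=\varphi_\beta*v$ on $L^2(\mathbb R)$. Then for every $\beta>0$ and every $h\in L^2(0,\infty)$ the functional $f\mapsto\|h-Lf\|^2+\|(I-C_\beta)Vf\|^2$ has exactly one minimizer over $L^2(0,\infty)$; it is called the regularized solution for the data $h$ and the parameter $\beta$. Let $c>0$ and $\theta\in(0,1)$, and let $\beta(\delta)=c\,\delta^{\theta/s}$ for $\delta>0$. There is a constant $C>0$, and for every $p>0$ there are constants $K,m,M>0$, such that the following holds for all $f,g\in L^2(0,\infty)$ with $g=Lf$ and $Vf\in H^p(\mathbb R)$. There is exactly one $w\in L^2(0,\infty)$ with $f=f_p(\overline L^*\overline L)w$, and $\rho:=\|w\|$ satisfies $m\rho\le\|Vf\|_{H^p}\le M\rho$, where $\|v\|_{H^p}^2=\int_{\mathbb R}(1+|\xi|^2)^p|\widehat v(\xi)|^2\,d\xi$. Moreover, if for each $\delta>0$ one has any noisy data $g^\delta\in L^2(0,\infty)$ with $\|g-g^\delta\|\le\delta$, and $f^\delta_{\beta(\delta)}$ denotes the regularized solution for the data $g^\delta$ and the parameter $\beta(\delta)$, then $$\|f-f^\delta_{\beta(\delta)}\|\le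 K\rho\,f_p(\delta^{2\theta})\,(1+o(1))+C\,\delta^{1-\theta}=\mathcal O\big(f_p(\delta^2)\big)\qquad\text{as }\delta\downarrow0 .$$ Here the inequality holds for all sufficiently small $\delta>0$, the threshold and the $o(1)$ term may depend on $f$ but not on the choice of the $g^\delta$, and $C$, $K$, $m$, $M$ do not depend on $f$, $g$, $\rho$, $\delta$ or the $g^\delta$. -/

import Mathlib

open MeasureTheory Set Filter Topology FourierTransform
open scoped ENNReal NNReal SchwartzMap

noncomputable section

namespace LaplaceMollification

/-- The complex Hilbert space `L²(0,∞)`. -/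
abbrev L2Half : Type := Lp ℂ 2 (volume.restrict (Ioi (0 : ℝ)))

/-- The complex Hilbert space `L²(ℝ)`. -/
abbrev L2Line : Type := Lp ℂ 2 (volume : Measure ℝ)

/-! ### The Laplace transform on the half-line -/

/-- `(L f)(x) = ∫₀^∞ e^{-xτ} f(τ) dτ`. -/
def laplaceFun (f : ℝ → ℂ) (x : ℝ) : ℂ :=
  ∫ τ in Ioi (0 : ℝ), (Real.exp (-(x * τ)) : ℂ) * f τ

lemma lintegral_rpow_exp {a : ℝ} (ha : 0 < a) :
    ∫⁻ τ in Ioi (0 : ℝ), ENNReal.ofReal (τ ^ (-(1 / 2) : ℝ) * Real.exp (-(a * τ))) =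
      ENNReal.ofReal (√Real.pi * a ^ (-(1 / 2) : ℝ)) := by
  have h := Real.integral_rpow_mul_exp_neg_mul_Ioi (a := 1 / 2) (r := a) (by norm_num) ha
  have e1 : ((1 : ℝ) / 2 - 1) = -(1 / 2) := by norm_num
  rw [e1, Real.Gamma_one_half_eq, one_div a, Real.inv_rpow ha.le, ← Real.rpow_neg ha.le] at h
  have hpos : 0 < √Real.pi * a ^ (-(1 / 2) : ℝ) := by positivity
  have hint : Integrable (fun τ : ℝ => τ ^ (-(1 / 2) : ℝ) * Real.exp (-(a * τ)))
      (volume.restrict (Ioi (0 : ℝ))) := by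
    by_contra hc
    have h0 := integral_undef hc
    have : a ^ (-(1 / 2) : ℝ) * √Real.pi = 0 := by
      rw [← h0, h]
    rw [mul_comm] at this
    exact hpos.ne' this
  rw [← ofReal_integral_eq_lintegral_ofReal hint]
  · rw [h, mul_comm]
  · filter_upwards [ae_restrict_mem measurableSet_Ioi] with τ hτ
    have : (0 : ℝ) < τ := hτ
    positivity

lemma integrable_laplace {f : ℝ → ℂ} (hf : MemLp f 2 (volume.restrict (Ioi (0 : ℝ))))
    {x : ℝ} (hx : 0 < x) :
    Integrable (fun τ : ℝ => (Real.exp (-(x * τ)) : ℂ) * f τ)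
      (volume.restrict (Ioi (0 : ℝ))) := by
  have he : MemLp (fun τ : ℝ => (Real.exp (-(x * τ)) : ℂ)) 2
      (volume.restrict (Ioi (0 : ℝ))) := by
    have hm : AEStronglyMeasurable (fun τ : ℝ => (Real.exp (-(x * τ)) : ℂ))
        (volume.restrict (Ioi (0 : ℝ))) := by
      apply Continuous.aestronglyMeasurable; fun_prop
    rw [memLp_two_iff_integrable_sq_norm hm]
    have h2 := integrableOn_exp_mul_Ioi (a := -(2 * x)) (by linarith) 0
    refine h2.congr (ae_of_all _ fun τ => ?_)
    simp only [Complex.norm_real, Real.norm_eq_abs, Real.abs_exp]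
    rw [← Real.exp_nat_mul]
    congr 1; push_cast; ring
  exact he.integrable_mul hf

lemma aestronglyMeasurable_laplaceFun {f : ℝ → ℂ}
    (hf : MemLp f 2 (volume.restrict (Ioi (0 : ℝ)))) :
    AEStronglyMeasurable (laplaceFun f) (volume.restrict (Ioi (0 : ℝ))) := by
  unfold laplaceFun
  refine AEStronglyMeasurable.integral_prod_right'
    (f := fun z : ℝ × ℝ => (Real.exp (-(z.1 * z.2)) : ℂ) * f z.2) ?_
  refine AEStronglyMeasurable.mul ?_ hf.1.comp_snd
  apply Continuous.aestronglyMeasurable; fun_prop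

lemma enorm_laplaceFun_sq_le {f : ℝ → ℂ} (hf : MemLp f 2 (volume.restrict (Ioi (0 : ℝ))))
    {x : ℝ} (hx : 0 < x) :
    ‖laplaceFun f x‖ₑ ^ 2 ≤ ENNReal.ofReal (√Real.pi * x ^ (-(1 / 2) : ℝ)) *
      ∫⁻ τ in Ioi (0 : ℝ), ENNReal.ofReal (τ ^ (1 / 2 : ℝ) * Real.exp (-(x * τ))) *
        ‖f τ‖ₑ ^ 2 := by
  set μ := volume.restrict (Ioi (0 : ℝ)) with hμ
  set A : ℝ → ℝ≥0∞ := fun τ =>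
    ENNReal.ofReal (τ ^ (-(1 / 4) : ℝ) * Real.exp (-(x * τ) / 2)) with hA
  set B : ℝ → ℝ≥0∞ := fun τ =>
    ENNReal.ofReal (τ ^ (1 / 4 : ℝ) * Real.exp (-(x * τ) / 2)) * ‖f τ‖ₑ with hB
  have hAm : AEMeasurable A μ := by
    apply Measurable.aemeasurable; fun_prop
  have hBm : AEMeasurable B μ := by
    refine AEMeasurable.mul ?_ hf.1.enorm
    apply Measurable.aemeasurable; fun_prop
  have h1 : ‖laplaceFun f x‖ₑ ≤ ∫⁻ τ, (A * B) τ ∂μ := by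
    refine (enorm_integral_le_lintegral_enorm _).trans (le_of_eq ?_)
    refine lintegral_congr_ae ?_
    filter_upwards [ae_restrict_mem measurableSet_Ioi] with τ hτ
    have hτ' : (0 : ℝ) < τ := hτ
    simp only [hA, hB, Pi.mul_apply]
    rw [← mul_assoc, ← ENNReal.ofReal_mul (by positivity), enorm_mul]
    congr 1
    rw [← ofReal_norm]
    congr 1
    rw [Complex.norm_real, Real.norm_eq_abs, Real.abs_exp]
    have e1 : τ ^ (-(1 / 4) : ℝ) * τ ^ (1 / 4 : ℝ) = 1 := by
      rw [← Real.rpow_add hτ']; norm_num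
    have e2 : Real.exp (-(x * τ) / 2) * Real.exp (-(x * τ) / 2) = Real.exp (-(x * τ)) := by
      rw [← Real.exp_add]; congr 1; ring
    calc Real.exp (-(x * τ)) = (τ ^ (-(1 / 4) : ℝ) * τ ^ (1 / 4 : ℝ)) *
          (Real.exp (-(x * τ) / 2) * Real.exp (-(x * τ) / 2)) := by rw [e1, e2, one_mul]
      _ = _ := by ring
  have h2 := ENNReal.lintegral_mul_le_Lp_mul_Lq μ Real.HolderConjugate.two_two hAm hBm
  have hA2 : ∫⁻ τ, A τ ^ (2 : ℝ) ∂μ = ENNReal.ofReal (√Real.pi * x ^ (-(1 / 2) : ℝ)) := by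
    rw [← lintegral_rpow_exp hx]
    refine lintegral_congr_ae ?_
    filter_upwards [ae_restrict_mem measurableSet_Ioi] with τ hτ
    have hτ' : (0 : ℝ) < τ := hτ
    simp only [hA]
    rw [ENNReal.rpow_two, ← ENNReal.ofReal_pow (by positivity), mul_pow, ← Real.rpow_natCast,
      ← Real.rpow_mul hτ'.le, ← Real.exp_nat_mul]
    congr 3
    · norm_num
    · push_cast; ring
  have hB2 : ∫⁻ τ, B τ ^ (2 : ℝ) ∂μ =
      ∫⁻ τ, ENNReal.ofReal (τ ^ (1 / 2 : ℝ) * Real.exp (-(x * τ))) * ‖f τ‖ₑ ^ 2 ∂μ := by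
    refine lintegral_congr_ae ?_
    filter_upwards [ae_restrict_mem measurableSet_Ioi] with τ hτ
    have hτ' : (0 : ℝ) < τ := hτ
    simp only [hB]
    rw [ENNReal.rpow_two, mul_pow, ← ENNReal.ofReal_pow (by positivity), mul_pow,
      ← Real.rpow_natCast, ← Real.rpow_mul hτ'.le, ← Real.exp_nat_mul]
    congr 4
    · norm_num
    · push_cast; ring
  rw [hA2, hB2] at h2
  calc ‖laplaceFun f x‖ₑ ^ 2 ≤ (∫⁻ τ, (A * B) τ ∂μ) ^ 2 := by gcongr
    _ ≤ _ := by
      refine (pow_le_pow_left' h2 2).trans (le_of_eq ?_)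
      rw [mul_pow, ← ENNReal.rpow_two, ← ENNReal.rpow_two, ← ENNReal.rpow_mul,
        ← ENNReal.rpow_mul]
      norm_num

lemma lintegral_laplaceFun_sq_le {f : ℝ → ℂ}
    (hf : MemLp f 2 (volume.restrict (Ioi (0 : ℝ)))) :
    ∫⁻ x in Ioi (0 : ℝ), ‖laplaceFun f x‖ₑ ^ 2 ≤
      ENNReal.ofReal Real.pi * ∫⁻ τ in Ioi (0 : ℝ), ‖f τ‖ₑ ^ 2 := by
  set μ := volume.restrict (Ioi (0 : ℝ)) with hμ
  have hmeas : AEMeasurable (fun z : ℝ × ℝ =>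
      ENNReal.ofReal (√Real.pi * z.1 ^ (-(1 / 2) : ℝ)) *
        (ENNReal.ofReal (z.2 ^ (1 / 2 : ℝ) * Real.exp (-(z.1 * z.2))) * ‖f z.2‖ₑ ^ 2))
      (μ.prod μ) := by
    have h1 : AEMeasurable (fun z : ℝ × ℝ =>
        ENNReal.ofReal (√Real.pi * z.1 ^ (-(1 / 2) : ℝ))) (μ.prod μ) := by
      apply Measurable.aemeasurable; fun_prop
    have h2 : AEMeasurable (fun z : ℝ × ℝ =>
        ENNReal.ofReal (z.2 ^ (1 / 2 : ℝ) * Real.exp (-(z.1 * z.2)))) (μ.prod μ) := by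
      apply Measurable.aemeasurable; fun_prop
    exact h1.mul (h2.mul ((hf.1.comp_snd.enorm).pow_const 2))
  calc ∫⁻ x, ‖laplaceFun f x‖ₑ ^ 2 ∂μ
      ≤ ∫⁻ x, ∫⁻ τ, ENNReal.ofReal (√Real.pi * x ^ (-(1 / 2) : ℝ)) *
          (ENNReal.ofReal (τ ^ (1 / 2 : ℝ) * Real.exp (-(x * τ))) * ‖f τ‖ₑ ^ 2) ∂μ ∂μ := by
        refine lintegral_mono_ae ?_
        filter_upwards [ae_restrict_mem measurableSet_Ioi] with x hx
        rw [lintegral_const_mul' _ _ ENNReal.ofReal_ne_top]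
        exact enorm_laplaceFun_sq_le hf hx
    _ = ∫⁻ τ, ∫⁻ x, ENNReal.ofReal (√Real.pi * x ^ (-(1 / 2) : ℝ)) *
          (ENNReal.ofReal (τ ^ (1 / 2 : ℝ) * Real.exp (-(x * τ))) * ‖f τ‖ₑ ^ 2) ∂μ ∂μ :=
        lintegral_lintegral_swap hmeas
    _ = ∫⁻ τ, ENNReal.ofReal Real.pi * ‖f τ‖ₑ ^ 2 ∂μ := by
        refine lintegral_congr_ae ?_
        filter_upwards [ae_restrict_mem measurableSet_Ioi] with τ hτ
        have hτ' : (0 : ℝ) < τ := hτ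
        have e : ∀ᵐ x ∂μ, ENNReal.ofReal (√Real.pi * x ^ (-(1 / 2) : ℝ)) *
            (ENNReal.ofReal (τ ^ (1 / 2 : ℝ) * Real.exp (-(x * τ))) * ‖f τ‖ₑ ^ 2) =
            (ENNReal.ofReal (√Real.pi * τ ^ (1 / 2 : ℝ)) * ‖f τ‖ₑ ^ 2) *
              ENNReal.ofReal (x ^ (-(1 / 2) : ℝ) * Real.exp (-(τ * x))) := by
          filter_upwards [ae_restrict_mem measurableSet_Ioi] with x hx
          have hx' : (0 : ℝ) < x := hx
          rw [← mul_assoc, ← ENNReal.ofReal_mul (by positivity),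
            mul_right_comm (ENNReal.ofReal (√Real.pi * τ ^ (1 / 2 : ℝ))),
            ← ENNReal.ofReal_mul (by positivity), mul_comm τ x]
          congr 2; ring
        rw [lintegral_congr_ae e, lintegral_const_mul' _ _
          (ENNReal.mul_ne_top ENNReal.ofReal_ne_top (by simp)), lintegral_rpow_exp hτ',
          mul_right_comm, ← ENNReal.ofReal_mul (by positivity)]
        congr 2
        have e1 : τ ^ (1 / 2 : ℝ) * τ ^ (-(1 / 2) : ℝ) = 1 := by
          rw [← Real.rpow_add hτ']; norm_num
        calc √Real.pi * τ ^ (1 / 2 : ℝ) * (√Real.pi * τ ^ (-(1 / 2) : ℝ))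
            = (√Real.pi * √Real.pi) * (τ ^ (1 / 2 : ℝ) * τ ^ (-(1 / 2) : ℝ)) := by ring
          _ = Real.pi := by rw [e1, Real.mul_self_sqrt Real.pi_pos.le, mul_one]
    _ = _ := lintegral_const_mul' _ _ ENNReal.ofReal_ne_top

lemma eLpNorm_laplaceFun_le {f : ℝ → ℂ} (hf : MemLp f 2 (volume.restrict (Ioi (0 : ℝ)))) :
    eLpNorm (laplaceFun f) 2 (volume.restrict (Ioi (0 : ℝ))) ≤
      ENNReal.ofReal (√Real.pi) * eLpNorm f 2 (volume.restrict (Ioi (0 : ℝ))) := by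
  rw [eLpNorm_eq_lintegral_rpow_enorm_toReal (by norm_num) (by norm_num),
    eLpNorm_eq_lintegral_rpow_enorm_toReal (by norm_num) (by norm_num)]
  simp only [ENNReal.toReal_ofNat, ENNReal.rpow_two]
  refine (ENNReal.rpow_le_rpow (lintegral_laplaceFun_sq_le hf) (by norm_num)).trans
    (le_of_eq ?_)
  rw [ENNReal.mul_rpow_of_nonneg _ _ (by norm_num), Real.sqrt_eq_rpow,
    ENNReal.ofReal_rpow_of_nonneg Real.pi_pos.le (by norm_num)]

lemma memLp_laplaceFun (f : L2Half) :
    MemLp (laplaceFun f) 2 (volume.restrict (Ioi (0 : ℝ))) :=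
  ⟨aestronglyMeasurable_laplaceFun (Lp.memLp f),
    (eLpNorm_laplaceFun_le (Lp.memLp f)).trans_lt
      (ENNReal.mul_lt_top ENNReal.ofReal_lt_top (Lp.memLp f).2)⟩

/-- The Laplace transform as a bounded operator `L` of `L²(0,∞)` into itself:
`(L f)(x) = ∫₀^∞ e^{-xτ} f(τ) dτ` for almost every `x > 0`. -/
def laplace : L2Half →L[ℂ] L2Half :=
  LinearMap.mkContinuous
    { toFun := fun f => (memLp_laplaceFun f).toLp (laplaceFun f)
      map_add' := fun f g => by
        rw [← MemLp.toLp_add, MemLp.toLp_eq_toLp_iff]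
        filter_upwards [ae_restrict_mem measurableSet_Ioi] with x hx
        simp only [Pi.add_apply, laplaceFun]
        rw [← integral_add (integrable_laplace (Lp.memLp f) hx)
          (integrable_laplace (Lp.memLp g) hx)]
        refine integral_congr_ae ?_
        filter_upwards [Lp.coeFn_add f g] with τ hτ
        rw [hτ, Pi.add_apply, mul_add]
      map_smul' := fun a f => by
        rw [RingHom.id_apply, ← MemLp.toLp_const_smul, MemLp.toLp_eq_toLp_iff]
        refine ae_of_all _ fun x => ?_
        simp only [Pi.smul_apply, laplaceFun]
        rw [← integral_smul]
        refine integral_congr_ae ?_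
        filter_upwards [Lp.coeFn_smul a f] with τ hτ
        rw [hτ, Pi.smul_apply, smul_eq_mul, smul_eq_mul]; ring }
    (√Real.pi) (fun f => by
      have h := eLpNorm_laplaceFun_le (Lp.memLp f)
      simp only [LinearMap.coe_mk, AddHom.coe_mk]
      rw [Lp.norm_toLp, Lp.norm_def]
      refine (ENNReal.toReal_mono
        (ENNReal.mul_ne_top ENNReal.ofReal_ne_top (Lp.memLp f).2.ne) h).trans (le_of_eq ?_)
      rw [ENNReal.toReal_mul, ENNReal.toReal_ofReal (Real.sqrt_nonneg _)])

/-! ### The logarithmic change of variable -/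

lemma quasiMeasurePreserving_exp :
    Measure.QuasiMeasurePreserving Real.exp volume (volume.restrict (Ioi (0 : ℝ))) := by
  refine ⟨Real.measurable_exp, Measure.AbsolutelyContinuous.mk fun N hN h0 => ?_⟩
  rw [Measure.map_apply Real.measurable_exp hN]
  rw [Measure.restrict_apply hN] at h0
  have hsub : Real.exp ⁻¹' N ⊆ Real.log '' (N ∩ Ioi 0) := fun u hu =>
    ⟨Real.exp u, ⟨hu, Real.exp_pos u⟩, Real.log_exp u⟩
  refine measure_mono_null hsub
    (addHaar_image_eq_zero_of_differentiableOn_of_addHaar_eq_zero volume ?_ h0)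
  intro x hx
  exact (Real.differentiableAt_log (ne_of_gt hx.2)).differentiableWithinAt

lemma memLp_logChange (f : L2Half) :
    MemLp (fun u : ℝ => (Real.exp (u / 2) : ℂ) * f (Real.exp u)) 2 volume := by
  refine ⟨?_, ?_⟩
  · refine AEStronglyMeasurable.mul ?_ ?_
    · apply Continuous.aestronglyMeasurable; fun_prop
    · exact (Lp.memLp f).1.comp_quasiMeasurePreserving quasiMeasurePreserving_exp
  · have h := lintegral_image_eq_lintegral_abs_deriv_mul (s := univ) (f := Real.exp)
      (f' := Real.exp) MeasurableSet.univ (fun x _ => (Real.hasDerivAt_exp x).hasDerivWithinAt)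
      Real.exp_injective.injOn (fun x => ‖f x‖ₑ ^ (2 : ℝ))
    rw [image_univ, Real.range_exp, Measure.restrict_univ] at h
    have hf := (eLpNorm_lt_top_iff_lintegral_rpow_enorm_lt_top (by norm_num) (by norm_num)).1
      (Lp.memLp f).2
    rw [eLpNorm_lt_top_iff_lintegral_rpow_enorm_lt_top (by norm_num) (by norm_num)]
    simp only [ENNReal.toReal_ofNat] at hf ⊢
    rw [h] at hf
    refine lt_of_eq_of_lt (lintegral_congr fun u => ?_) hf
    rw [enorm_mul, ENNReal.mul_rpow_of_nonneg _ _ (by norm_num)]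
    congr 1
    rw [← ofReal_norm, Complex.norm_real, Real.norm_eq_abs, Real.abs_exp,
      ENNReal.rpow_two, ← ENNReal.ofReal_pow (Real.exp_pos _).le, ← Real.exp_nat_mul,
      Real.abs_exp]
    congr 2; push_cast; ring

/-- The operator `V : L²(0,∞) → L²(ℝ)`, `(V f)(u) = e^{u/2} f(e^u)`. -/
def logChange (f : L2Half) : L2Line :=
  (memLp_logChange f).toLp (fun u : ℝ => (Real.exp (u / 2) : ℂ) * f (Real.exp u))

/-! ### The mollifier -/

/-- The Fourier transform `φ̂(ξ) = (2π)^{-1/2} ∫ e^{-iξt} φ(t) dt`. -/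
def unitaryFourier (φ : ℝ → ℂ) (ξ : ℝ) : ℂ :=
  ((√(2 * Real.pi))⁻¹ : ℂ) * ∫ t : ℝ, Complex.exp (-(Complex.I * ξ * t)) * φ t

/-- The standing assumptions on the mollifier `φ`: it is integrable with unit integral, `φ̂` is
real-valued with `φ̂(ξ) < 1/√(2π)` for `ξ ≠ 0`, `φ̂(ξ)` decreases as `|ξ|` increases, and
`|1 - √(2π) φ̂(ξ)| ∼ |ξ|^s` as `ξ → 0`. -/
structure IsMollifier (φ : ℝ → ℂ) (s : ℝ) : Prop where
  integrable : Integrable φ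
  integral_eq_one : ∫ t : ℝ, φ t = 1
  real_valued : ∀ ξ : ℝ, (unitaryFourier φ ξ).im = 0
  lt_max : ∀ ξ : ℝ, ξ ≠ 0 → (unitaryFourier φ ξ).re < 1 / √(2 * Real.pi)
  decreasing : ∀ ξ η : ℝ, |ξ| ≤ |η| → (unitaryFourier φ η).re ≤ (unitaryFourier φ ξ).re
  equivalent : Asymptotics.IsEquivalent (𝓝[≠] 0)
    (fun ξ : ℝ => ‖1 - (√(2 * Real.pi) : ℂ) * unitaryFourier φ ξ‖) (fun ξ : ℝ => |ξ| ^ s)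

/-- `φ_β(t) = β⁻¹ φ(t/β)`. -/
def dilate (φ : ℝ → ℂ) (β : ℝ) (t : ℝ) : ℂ := (β⁻¹ : ℂ) * φ (t / β)

/-- `C_β v = φ_β ∗ v`. -/
def mollify (φ : ℝ → ℂ) (β : ℝ) (v : L2Line) : ℝ → ℂ :=
  MeasureTheory.convolution (dilate φ β) v (ContinuousLinearMap.mul ℂ ℂ) volume

/-! ### The regularized solution -/

/-- The functional `f ↦ ‖g - L f‖² + ‖(I - C_β) V f‖²`. -/
def objective (φ : ℝ → ℂ) (β : ℝ) (g f : L2Half) : ℝ≥0∞ :=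
  ‖g - laplace f‖ₑ ^ 2 +
    eLpNorm (fun u => logChange f u - mollify φ β (logChange f) u) 2 volume ^ 2

/-- `h` minimizes `f ↦ ‖g - L f‖² + ‖(I - C_β) V f‖²` over `L²(0,∞)`. -/
def IsRegularizedSolution (φ : ℝ → ℂ) (β : ℝ) (g h : L2Half) : Prop :=
  ∀ f : L2Half, objective φ β g h ≤ objective φ β g f

/-! ### Smoothness and the logarithmic source condition -/

/-- The norm `‖v‖_{H^p} = (∫ (1 + |ξ|²)^p |v̂(ξ)|² dξ)^{1/2}`, where `v̂` is the unitary transform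
`v̂(ξ) = (2π)^{-1/2} ∫ e^{-iξt} v(t) dt`. With Mathlib's `𝓕 v (η) = ∫ e^{-2πiηt} v(t) dt` this is,
through `ξ = 2πη`, the `L²`-norm of `(1 + (2πη)²)^{p/2} 𝓕 v (η)`. -/
def sobolevNorm (p : ℝ) (v : L2Line) : ℝ≥0∞ :=
  eLpNorm (fun η : ℝ => (((1 + (2 * Real.pi * η) ^ 2) ^ (p / 2) : ℝ) : ℂ) *
    (𝓕 v : L2Line) η) 2 volume

/-- `v ∈ H^p(ℝ)`. -/
def MemHp (p : ℝ) (v : L2Line) : Prop :=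
  TemperedDistribution.MemSobolev p 2 (v : 𝓢'(ℝ, ℂ))

/-- The function `f_p(t) = (-ln t)^{-p}`, `0 < t < 1`. For `p > 0` the expression has the value `0`
at `t = 0`, which is the continuous extension. -/
def logSource (p t : ℝ) : ℝ := (-Real.log t) ^ (-p)

/-- The normalized operator `L / √(π e)`. -/
def normalizedLaplace : L2Half →L[ℂ] L2Half :=
  ((√(Real.pi * Real.exp 1))⁻¹ : ℂ) • laplace

/-- `F(T* T)` for a bounded operator `T` on a complex Hilbert space and a real function `F` that is
continuous on the spectrum of `T* T`: continuous functional calculus of a self-adjoint operator. -/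
def functionOfAdjointMul {H : Type*} [NormedAddCommGroup H] [InnerProductSpace ℂ H]
    [CompleteSpace H] (F : ℝ → ℝ) (T : H →L[ℂ] H) : H →L[ℂ] H :=
  cfc F (ContinuousLinearMap.adjoint T ∘L T)

/-- The operator `f_p(T* T)`, `T = L / √(π e)`; the spectrum of `T* T` lies in `[0, e⁻¹]`, and
`f_p` is continuous there. -/
def sourceOperator (p : ℝ) : L2Half →L[ℂ] L2Half :=
  functionOfAdjointMul (logSource p) normalizedLaplace

/-- The bound `K ρ f_p(δ^{2θ}) (1 + ε(δ)) + C δ^{1-θ}`. -/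
def errorBound (p θ K C ρ : ℝ) (ε : ℝ → ℝ) (δ : ℝ) : ℝ :=
  K * ρ * logSource p (δ ^ (2 * θ)) * (1 + ε δ) + C * δ ^ (1 - θ)

end LaplaceMollification

end

open scoped BoundedContinuousFunction

noncomputable section

namespace LaplaceMollification

/-! ### Multiplication operators -/

/-! The unitary operator `fourierLog` = 𝓕V diagonalizes everything at once. In logarithmic variables
L is a reflection followed by convolution with e^{t/2} exp(-e^t), whose Fourier transform is Γ(1/2 -
2πiη). The reflection formula for Γ then makes L*L multiplication by λ(η) = π / cosh(2π²η)
(`fourierLog_adjoint_laplace`), and the convolution theorem (`convolution_ae_eq`) makes I - C_β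
multiplication by a(βη), where a(η) = 1 - √(2π) φ̂(2πη) ≥ 0.

The normal equation of the functional is therefore division by N(η) = λ(η) + a(βη)². This symbol is
bounded below, and completing the square (`IsMollifier.energy_eq`) gives existence and uniqueness of
the minimizer.

By functional calculus f_p(L̄*L̄) is multiplication by Λ^{-p} with Λ(η) = 1 + ln cosh(2π²η). Since Λ
is comparable to (1 + (2πη)²)^{1/2}, the source condition is the same as Sobolev smoothness of Vf
(`exists_source_of_memHp`).

The error splits into noise and bias. The noise is amplified by at most sup √λ/N. For |η| ≤ 1 this
is bounded because λ is bounded below; for |η| ≥ 1 monotonicity gives a(βη) ≥ a(β), of order β^s and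
so of order δ^θ. The amplification is thus O(δ^{-θ}) (`IsMollifier.exists_noise_bound`).

The bias is at most sup (a(βη)²/N) Λ^{-p} times ‖w‖ (`IsMollifier.exists_bias_bound`). Cut the
frequencies at |η| = κ ln(1/δ). Below the cut 1/λ ≤ δ^{-θ}, while a(βη)² is O(δ^{2θ}) up to
logarithms, so a power of δ is left over and beats any power of the logarithm. Above the cut a²/N ≤
1 and Λ ≥ θ ln(1/δ), which gives the logarithmic rate. -/

lemma memLp_bcf_mul (m : ℝ →ᵇ ℂ) (v : L2Line) : MemLp (fun x => m x * v x) 2 volume :=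
  (Lp.memLp v).mul (p := ∞)
    (memLp_top_of_bound m.continuous.aestronglyMeasurable ‖m‖ (ae_of_all _ m.norm_coe_le_norm))

lemma norm_toLp_bcf_mul_le (m : ℝ →ᵇ ℂ) (v : L2Line) :
    ‖(memLp_bcf_mul m v).toLp _‖ ≤ ‖m‖ * ‖v‖ := by
  refine Lp.norm_le_mul_norm_of_ae_le_mul ?_
  filter_upwards [(memLp_bcf_mul m v).coeFn_toLp] with x hx
  rw [hx, norm_mul]
  gcongr
  exact m.norm_coe_le_norm x

/-- Multiplication by a bounded continuous function, as an operator of `L²(ℝ)`. -/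
def mulOp (m : ℝ →ᵇ ℂ) : L2Line →L[ℂ] L2Line :=
  LinearMap.mkContinuous
    { toFun := fun v => (memLp_bcf_mul m v).toLp _
      map_add' := fun v w => by
        rw [← MemLp.toLp_add, MemLp.toLp_eq_toLp_iff]
        filter_upwards [Lp.coeFn_add v w] with x hx
        rw [hx]; simp only [Pi.add_apply]; ring
      map_smul' := fun a v => by
        rw [RingHom.id_apply, ← MemLp.toLp_const_smul, MemLp.toLp_eq_toLp_iff]
        filter_upwards [Lp.coeFn_smul a v] with x hx
        rw [hx]; simp only [Pi.smul_apply, smul_eq_mul]; ring }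
    ‖m‖ (norm_toLp_bcf_mul_le m)

lemma mulOp_coeFn (m : ℝ →ᵇ ℂ) (v : L2Line) : mulOp m v =ᵐ[volume] fun x => m x * v x :=
  (memLp_bcf_mul m v).coeFn_toLp

lemma norm_mulOp_le (m : ℝ →ᵇ ℂ) : ‖mulOp m‖ ≤ ‖m‖ :=
  LinearMap.mkContinuous_norm_le _ (norm_nonneg _) _

lemma mulOp_mul (m n : ℝ →ᵇ ℂ) : mulOp (m * n) = mulOp m * mulOp n := by
  ext1 v
  refine Lp.ext ?_
  filter_upwards [mulOp_coeFn (m * n) v, mulOp_coeFn m (mulOp n v), mulOp_coeFn n v]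
    with x h1 h2 h3
  rw [h1, BoundedContinuousFunction.mul_apply, mul_assoc, ← h3, ← h2]
  rfl

lemma mulOp_add (m n : ℝ →ᵇ ℂ) : mulOp (m + n) = mulOp m + mulOp n := by
  ext1 v
  refine Lp.ext ?_
  filter_upwards [mulOp_coeFn (m + n) v, Lp.coeFn_add (mulOp m v) (mulOp n v), mulOp_coeFn m v,
    mulOp_coeFn n v] with x h1 h2 h3 h4
  rw [h1, BoundedContinuousFunction.add_apply, add_mul, ← h3, ← h4, ← Pi.add_apply, ← h2]
  rfl

lemma mulOp_const (c : ℂ) : mulOp (BoundedContinuousFunction.const ℝ c) = c • 1 := by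
  ext1 v
  refine Lp.ext ?_
  filter_upwards [mulOp_coeFn (BoundedContinuousFunction.const ℝ c) v, Lp.coeFn_smul c v]
    with x h1 h2
  exact h1.trans h2.symm

lemma inner_mulOp_right (m : ℝ →ᵇ ℂ) (v w : L2Line) :
    inner ℂ v (mulOp m w) = ∫ x, m x * (w x * (starRingEnd ℂ) (v x)) := by
  rw [L2.inner_def]
  refine integral_congr_ae ?_
  filter_upwards [mulOp_coeFn m w] with x hx
  rw [hx, RCLike.inner_apply, mul_assoc]

lemma mulOp_star (m : ℝ →ᵇ ℂ) : mulOp (star m) = star (mulOp m) := by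
  rw [ContinuousLinearMap.star_eq_adjoint, ContinuousLinearMap.eq_adjoint_iff]
  intro v w
  rw [inner_mulOp_right, L2.inner_def]
  refine integral_congr_ae ?_
  filter_upwards [mulOp_coeFn (star m) v] with x hx
  rw [hx, RCLike.inner_apply, BoundedContinuousFunction.star_apply]
  simp only [map_mul, RCLike.star_def, Complex.conj_conj]
  ring

/-- Multiplication operators form a representation of the bounded continuous functions. -/
def mulOpHom : (ℝ →ᵇ ℂ) →⋆ₐ[ℂ] (L2Line →L[ℂ] L2Line) where
  toFun := mulOp
  map_one' := (mulOp_const 1).trans (one_smul _ _)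
  map_mul' := mulOp_mul
  map_zero' := (mulOp_const 0).trans (zero_smul _ _)
  map_add' := mulOp_add
  commutes' := fun c => (mulOp_const c).trans (Algebra.algebraMap_eq_smul_one c).symm
  map_star' := mulOp_star

/-! ### Functional calculus of real multipliers -/

/-- A bounded continuous real function, as an element of the C*-algebra of bounded continuous
complex functions. -/
def realMultiplier (m : ℝ → ℝ) (hm : Continuous m) (B : ℝ) (hB : ∀ x, |m x| ≤ B) : ℝ →ᵇ ℂ :=
  BoundedContinuousFunction.ofNormedAddCommGroup (fun x => (m x : ℂ))
    (Complex.continuous_ofReal.comp hm) B (fun x => by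
      rw [Complex.norm_real]; exact hB x)

@[simp]
lemma realMultiplier_apply (m : ℝ → ℝ) (hm : Continuous m) (B : ℝ) (hB : ∀ x, |m x| ≤ B) (x : ℝ) :
    realMultiplier m hm B hB x = m x := rfl

lemma isSelfAdjoint_realMultiplier (m : ℝ → ℝ) (hm : Continuous m) (B : ℝ)
    (hB : ∀ x, |m x| ≤ B) : IsSelfAdjoint (realMultiplier m hm B hB) := by
  ext x
  simp [BoundedContinuousFunction.star_apply]

instance : ContinuousFunctionalCalculus ℝ (ℝ →ᵇ ℂ) IsSelfAdjoint :=
  IsSelfAdjoint.instContinuousFunctionalCalculus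

/-- Evaluation at a point, as a homomorphism of star algebras. -/
def evalStarHom (x : ℝ) : (ℝ →ᵇ ℂ) →⋆ₐ[ℂ] ℂ where
  toFun m := m x
  map_one' := rfl
  map_mul' _ _ := rfl
  map_zero' := rfl
  map_add' _ _ := rfl
  commutes' _ := by simp
  map_star' _ := rfl

/-- A number r outside [a, b] keeps a positive distance from all values of m, so 1/(r - m) is again
bounded and continuous and inverts r - m. -/
lemma spectrum_realMultiplier_subset (m : ℝ → ℝ) (hm : Continuous m) (B : ℝ)
    (hB : ∀ x, |m x| ≤ B) {a b : ℝ} (hab : ∀ x, m x ∈ Icc a b) :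
    spectrum ℝ (realMultiplier m hm B hB) ⊆ Icc a b := by
  intro r hr
  by_contra hrab
  apply hr
  obtain ⟨d, hd, hdist⟩ : ∃ d > 0, ∀ x, d ≤ |r - m x| := by
    rw [mem_Icc, not_and_or, not_le, not_le] at hrab
    rcases hrab with h | h
    · exact ⟨a - r, by linarith, fun x => by
        rw [abs_sub_comm]; exact le_trans (by linarith [(hab x).1]) (le_abs_self _)⟩
    · exact ⟨r - b, by linarith, fun x =>
        le_trans (by linarith [(hab x).2]) (le_abs_self _)⟩
  have hne : ∀ x, r - m x ≠ 0 := fun x h => by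
    have := hdist x
    rw [h, abs_zero] at this
    linarith
  refine IsUnit.of_mul_eq_one (realMultiplier (fun x => (r - m x)⁻¹)
    ((continuous_const.sub hm).inv₀ hne) d⁻¹ (fun x => ?_)) ?_
  · rw [abs_inv]
    exact inv_anti₀ hd (hdist x)
  · ext x
    simp only [BoundedContinuousFunction.mul_apply, BoundedContinuousFunction.sub_apply,
      realMultiplier_apply]
    have : (algebraMap ℝ (ℝ →ᵇ ℂ) r) x = (r : ℂ) := rfl
    rw [this]
    have hc : ((r : ℂ) - m x) ≠ 0 := by exact_mod_cast hne x
    push_cast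
    exact mul_inv_cancel₀ hc

/-- Functional calculus of a real multiplier is composition. -/
lemma cfc_realMultiplier_apply (F m : ℝ → ℝ) (hm : Continuous m) (B : ℝ) (hB : ∀ x, |m x| ≤ B)
    {a b : ℝ} (hab : ∀ x, m x ∈ Icc a b) (hF : ContinuousOn F (Icc a b)) (x : ℝ) :
    cfc F (realMultiplier m hm B hB) x = F (m x) := by
  -- Continuous star homomorphisms commute with the functional calculus; evaluation at x reduces the
  -- claim to the calculus of a scalar.
  have h := StarAlgHom.map_cfc (evalStarHom x) F (realMultiplier m hm B hB)
    (hF.mono (spectrum_realMultiplier_subset m hm B hB hab))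
    (BoundedContinuousFunction.evalCLM ℂ x : (ℝ →ᵇ ℂ) →L[ℂ] ℂ).continuous
    (isSelfAdjoint_realMultiplier m hm B hB)
    ((isSelfAdjoint_realMultiplier m hm B hB).map (evalStarHom x))
  refine h.trans ?_
  exact cfc_algebraMap (R := ℝ) (A := ℂ) (m x) F

/-- Functional calculus of an operator unitarily equivalent to a real multiplication operator. -/
lemma cfc_conj_mulOp {H : Type*} [NormedAddCommGroup H] [InnerProductSpace ℂ H] [CompleteSpace H]
    (U : H ≃ₗᵢ[ℂ] L2Line) (F m : ℝ → ℝ) (hm : Continuous m) (B : ℝ) (hB : ∀ x, |m x| ≤ B)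
    {a b : ℝ} (hab : ∀ x, m x ∈ Icc a b) (hF : ContinuousOn F (Icc a b)) (T : H →L[ℂ] H)
    (hT : ∀ f, U (T f) = mulOp (realMultiplier m hm B hB) (U f)) (f : H) :
    U (cfc F T f) =ᵐ[volume] fun x => (F (m x) : ℂ) * U f x := by
  -- Ψ(n) = U⁻¹ (multiplication by n) U is a continuous star homomorphism that sends m to T, so it
  -- carries F(m) = F ∘ m to F(T).
  set Ψ : (ℝ →ᵇ ℂ) →⋆ₐ[ℂ] (H →L[ℂ] H) :=
    (U.symm.conjStarAlgEquiv : _ →⋆ₐ[ℂ] _).comp mulOpHom with hΨ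
  have hΨapp : ∀ n f, U (Ψ n f) = mulOp n (U f) := fun n f => by
    simp only [hΨ, StarAlgHom.comp_apply]
    exact U.apply_symm_apply _
  have hΨT : Ψ (realMultiplier m hm B hB) = T := by
    ext1 f
    apply U.injective
    rw [hΨapp, hT]
  have hcont : Continuous Ψ := by
    refine AddMonoidHomClass.continuous_of_bound Ψ 1 fun n => ?_
    refine ContinuousLinearMap.opNorm_le_bound _ (by positivity) fun f => ?_
    rw [← U.norm_map, hΨapp, ← U.norm_map f, one_mul]
    exact (mulOp n).le_of_opNorm_le (norm_mulOp_le n) _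
  have h := StarAlgHom.map_cfc Ψ F (realMultiplier m hm B hB)
    (hF.mono (spectrum_realMultiplier_subset m hm B hB hab)) hcont
    (isSelfAdjoint_realMultiplier m hm B hB)
    ((isSelfAdjoint_realMultiplier m hm B hB).map Ψ)
  rw [hΨT] at h
  rw [← h, hΨapp]
  filter_upwards [mulOp_coeFn (cfc F (realMultiplier m hm B hB)) (U f)] with x hx
  rw [hx, cfc_realMultiplier_apply F m hm B hB hab hF]

/-! ### The logarithmic change of variable is unitary -/

lemma lintegral_Ioi_eq_lintegral_exp (F : ℝ → ℝ≥0∞) :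
    ∫⁻ x in Ioi (0 : ℝ), F x = ∫⁻ u : ℝ, ENNReal.ofReal (Real.exp u) * F (Real.exp u) := by
  have h := lintegral_image_eq_lintegral_abs_deriv_mul (s := univ) (f := Real.exp)
    (f' := Real.exp) MeasurableSet.univ (fun x _ => (Real.hasDerivAt_exp x).hasDerivWithinAt)
    Real.exp_injective.injOn F
  rw [image_univ, Real.range_exp, Measure.restrict_univ] at h
  rw [h]
  simp only [Real.abs_exp]

/-- The square of the factor e^{u/2} is the Jacobian of x = e^u. -/
lemma eLpNorm_exp_mul_comp_exp (f : ℝ → ℂ) :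
    eLpNorm (fun u : ℝ => (Real.exp (u / 2) : ℂ) * f (Real.exp u)) 2 volume =
      eLpNorm f 2 (volume.restrict (Ioi (0 : ℝ))) := by
  rw [eLpNorm_eq_lintegral_rpow_enorm_toReal (by norm_num) (by norm_num),
    eLpNorm_eq_lintegral_rpow_enorm_toReal (by norm_num) (by norm_num),
    lintegral_Ioi_eq_lintegral_exp]
  congr 1
  refine lintegral_congr fun u => ?_
  rw [enorm_mul, ENNReal.mul_rpow_of_nonneg _ _ (by norm_num)]
  congr 1
  rw [← ofReal_norm, Complex.norm_real, Real.norm_eq_abs, Real.abs_exp, ENNReal.toReal_ofNat,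
    ENNReal.rpow_two, ← ENNReal.ofReal_pow (Real.exp_pos _).le, ← Real.exp_nat_mul]
  congr 2; push_cast; ring

lemma logChange_coeFn (f : L2Half) :
    logChange f =ᵐ[volume] fun u : ℝ => (Real.exp (u / 2) : ℂ) * f (Real.exp u) :=
  (memLp_logChange f).coeFn_toLp

lemma ae_comp_exp {P : ℝ → Prop} (h : ∀ᵐ x ∂(volume.restrict (Ioi (0 : ℝ))), P x) :
    ∀ᵐ u : ℝ, P (Real.exp u) :=
  quasiMeasurePreserving_exp.ae h

/-- The change of variable `V` as a linear isometry. -/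
def logChangeIsometry : L2Half →ₗᵢ[ℂ] L2Line where
  toFun := logChange
  map_add' f g := by
    refine Lp.ext ?_
    filter_upwards [logChange_coeFn (f + g), logChange_coeFn f, logChange_coeFn g,
      Lp.coeFn_add (logChange f) (logChange g), ae_comp_exp (Lp.coeFn_add f g)]
      with u h1 h2 h3 h4 h5
    rw [h1, h4, Pi.add_apply, h2, h3, h5, Pi.add_apply, mul_add]
  map_smul' a f := by
    refine Lp.ext ?_
    filter_upwards [logChange_coeFn (a • f), logChange_coeFn f,
      Lp.coeFn_smul a (logChange f), ae_comp_exp (Lp.coeFn_smul a f)]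
      with u h1 h2 h4 h5
    rw [h1, RingHom.id_apply, h4, Pi.smul_apply, h2, h5, Pi.smul_apply, smul_eq_mul, smul_eq_mul]
    ring
  norm_map' f := by
    simp only [LinearMap.coe_mk, AddHom.coe_mk, logChange]
    rw [Lp.norm_toLp, Lp.norm_def, eLpNorm_exp_mul_comp_exp]

lemma logChange_surjective : Function.Surjective logChange := by
  intro v
  -- The preimage is x^{-1/2} v(ln x).
  set f₀ : ℝ → ℂ := fun x => (Real.exp (-(Real.log x / 2)) : ℂ) * v (Real.log x) with hf₀
  have hcomp : (fun u : ℝ => (Real.exp (u / 2) : ℂ) * f₀ (Real.exp u)) = v := by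
    funext u
    simp only [hf₀, Real.log_exp]
    rw [← mul_assoc, ← Complex.ofReal_mul, ← Real.exp_add, add_neg_cancel, Real.exp_zero]
    simp
  have hmem : MemLp f₀ 2 (volume.restrict (Ioi (0 : ℝ))) := by
    refine ⟨?_, ?_⟩
    · refine AEStronglyMeasurable.mul ?_ ?_
      · apply Measurable.aestronglyMeasurable
        fun_prop
      · exact ((Lp.stronglyMeasurable v).comp_measurable Real.measurable_log).aestronglyMeasurable
    · rw [← eLpNorm_exp_mul_comp_exp, hcomp]
      exact (Lp.memLp v).2
  refine ⟨hmem.toLp f₀, Lp.ext ?_⟩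
  filter_upwards [logChange_coeFn (hmem.toLp f₀), ae_comp_exp hmem.coeFn_toLp] with u h1 h2
  rw [h1, h2]
  exact congrFun hcomp u

/-- The unitary operator `f ↦ 𝓕 (V f)`. -/
def fourierLog : L2Half ≃ₗᵢ[ℂ] L2Line :=
  (LinearIsometryEquiv.ofSurjective logChangeIsometry logChange_surjective).trans
    (Lp.fourierTransformₗᵢ ℝ ℂ)

lemma fourierLog_apply (f : L2Half) : fourierLog f = 𝓕 (logChange f) := rfl

/-! ### Convolution of an integrable with a square-integrable function -/

/-- The L² transform agrees with the transform of tempered distributions, which is defined by this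
duality. All pointwise information on 𝓕 v below is extracted through this pairing. -/
lemma integral_schwartz_mul_fourier (v : L2Line) (z : 𝓢(ℝ, ℂ)) :
    ∫ x, z x * (𝓕 v : L2Line) x = ∫ x, (𝓕 z) x * v x := by
  have h := congrArg (fun T : 𝓢'(ℝ, ℂ) => T z) (Lp.fourier_toTemperedDistribution_eq v)
  simp only [TemperedDistribution.fourier_apply, Lp.toTemperedDistribution_apply,
    smul_eq_mul] at h
  exact h.symm

lemma lintegral_comp_sub_mul_le {v w : ℝ → ℂ} (hv : MemLp v 2 volume) (hw : MemLp w 2 volume)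
    (t : ℝ) :
    ∫⁻ x, ‖v (x - t) * w x‖ₑ ≤ eLpNorm v 2 volume * eLpNorm w 2 volume := by
  have hmp := measurePreserving_sub_right (volume : Measure ℝ) t
  have h := eLpNorm_smul_le_mul_eLpNorm (p := 2) (q := 2) (r := 1) (μ := (volume : Measure ℝ))
    hw.1 (hv.1.comp_measurePreserving hmp)
  rw [eLpNorm_comp_measurePreserving hv.1 hmp, eLpNorm_one_eq_lintegral_enorm] at h
  exact h

/-- Tonelli, with the inner integral bounded by Cauchy–Schwarz uniformly in the translation. It
justifies Fubini for the pairing of φ ∗ v with w. -/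
lemma integrable_convolution_pairing {φ v w : ℝ → ℂ} (hφ : Integrable φ)
    (hv : MemLp v 2 volume) (hw : MemLp w 2 volume) :
    Integrable (fun z : ℝ × ℝ => φ z.2 * (v (z.1 - z.2) * w z.1))
      ((volume : Measure ℝ).prod volume) := by
  have hmeas : AEStronglyMeasurable (fun z : ℝ × ℝ => φ z.2 * (v (z.1 - z.2) * w z.1))
      ((volume : Measure ℝ).prod volume) :=
    hφ.1.comp_snd.mul ((hv.1.comp_quasiMeasurePreserving
      (quasiMeasurePreserving_sub volume volume)).mul hw.1.comp_fst)
  refine ⟨hmeas, ?_⟩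
  rw [HasFiniteIntegral, lintegral_prod_symm _ hmeas.enorm]
  calc ∫⁻ t, ∫⁻ x, ‖φ t * (v (x - t) * w x)‖ₑ
      ≤ ∫⁻ t, ‖φ t‖ₑ * (eLpNorm v 2 volume * eLpNorm w 2 volume) := by
        refine lintegral_mono fun t => ?_
        simp only [enorm_mul (φ t)]
        rw [lintegral_const_mul' _ _ enorm_ne_top]
        gcongr
        exact lintegral_comp_sub_mul_le hv hw t
    _ = (∫⁻ t, ‖φ t‖ₑ) * (eLpNorm v 2 volume * eLpNorm w 2 volume) :=
        lintegral_mul_const' _ _ (ENNReal.mul_ne_top hv.2.ne hw.2.ne)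
    _ < ∞ := ENNReal.mul_lt_top hφ.2 (ENNReal.mul_lt_top hv.2 hw.2)

/-- Pairing with the indicator of a compact set reduces this to the preceding Fubini estimate. -/
lemma locallyIntegrable_convolution {φ v : ℝ → ℂ} (hφ : Integrable φ) (hv : MemLp v 2 volume) :
    LocallyIntegrable (convolution φ v (ContinuousLinearMap.mul ℂ ℂ) volume) := by
  rw [locallyIntegrable_iff]
  intro k hk
  have hw : MemLp (k.indicator fun _ => (1 : ℂ)) 2 volume :=
    memLp_indicator_const 2 hk.measurableSet 1 (Or.inr hk.measure_lt_top.ne)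
  have h := (integrable_convolution_pairing hφ hv hw).integral_prod_left
  rw [← integrable_indicator_iff hk.measurableSet]
  refine h.congr (ae_of_all _ fun x => ?_)
  by_cases hx : x ∈ k
  · simp [hx, convolution]
  · simp [hx]

/-- The Fourier transform of an integrable function, as a bounded continuous function. -/
def fourierMultiplier (φ : ℝ → ℂ) (hφ : Integrable φ) : ℝ →ᵇ ℂ :=
  BoundedContinuousFunction.ofNormedAddCommGroup (𝓕 φ)
    (VectorFourier.fourierIntegral_continuous Real.continuous_fourierChar continuous_inner hφ)
    (∫ t, ‖φ t‖) (fun _ => VectorFourier.norm_fourierIntegral_le_integral_norm _ _ _ _ _)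

lemma fourierMultiplier_apply (φ : ℝ → ℂ) (hφ : Integrable φ) (η : ℝ) :
    fourierMultiplier φ hφ η = 𝓕 φ η := rfl

/-- Translation becomes modulation under the Fourier transform. -/
lemma fourierInv_comp_sub (w : 𝓢(ℝ, ℂ)) (t η : ℝ) :
    (𝓕⁻ (w.compSubConstCLM ℂ (-t))) η = (Real.fourierChar (-(t * η)) : ℂ) * (𝓕⁻ w) η := by
  rw [SchwartzMap.fourierInv_coe, SchwartzMap.fourierInv_coe, Real.fourierInv_eq,
    Real.fourierInv_eq, ← integral_const_mul,
    ← integral_add_right_eq_self (μ := volume)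
      (fun x : ℝ => (Real.fourierChar (-(t * η)) : ℂ) *
        ((Real.fourierChar (inner ℝ x η)) • w x)) t]
  refine integral_congr_ae (ae_of_all _ fun x => ?_)
  simp only [SchwartzMap.compSubConstCLM_apply, sub_neg_eq_add, Circle.smul_def, smul_eq_mul]
  rw [← mul_assoc, ← Circle.coe_mul, ← AddChar.map_add_eq_mul]
  congr 3
  simp only [RCLike.inner_apply, conj_trivial]
  ring_nf

lemma integral_comp_sub_mul_schwartz (v : L2Line) (w : 𝓢(ℝ, ℂ)) (t : ℝ) :
    ∫ x, v (x - t) * w x =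
      ∫ η, (Real.fourierChar (-(t * η)) : ℂ) * ((𝓕⁻ w) η * (𝓕 v : L2Line) η) := by
  set w' := w.compSubConstCLM ℂ (-t) with hw'
  have h := integral_schwartz_mul_fourier v (𝓕⁻ w')
  rw [FourierTransform.fourier_fourierInv_eq] at h
  calc ∫ x, v (x - t) * w x = ∫ x, v x * w (x + t) := by
        rw [← integral_sub_right_eq_self (μ := volume) (fun x : ℝ => v x * w (x + t)) t]
        simp
    _ = ∫ x, w' x * v x := by
        refine integral_congr_ae (ae_of_all _ fun x => ?_)
        simp [hw', mul_comm]
    _ = _ := by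
        rw [← h]
        refine integral_congr_ae (ae_of_all _ fun η => ?_)
        simp only [hw', fourierInv_comp_sub, mul_assoc]

/-- The weak form of the convolution theorem: swap integrals, move the translate of v to the Fourier
side, swap back, and collect the characters into 𝓕 φ. -/
lemma integral_convolution_mul_schwartz {φ : ℝ → ℂ} (hφ : Integrable φ) (v : L2Line)
    (w : 𝓢(ℝ, ℂ)) :
    ∫ x, w x * convolution φ v (ContinuousLinearMap.mul ℂ ℂ) volume x =
      ∫ x, w x * (𝓕⁻ (mulOp (fourierMultiplier φ hφ) (𝓕 v)) : L2Line) x := by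
  set z : 𝓢(ℝ, ℂ) := 𝓕⁻ w with hz
  set u : L2Line := mulOp (fourierMultiplier φ hφ) (𝓕 v) with hu
  have hvz : Integrable (fun η => z η * (𝓕 v : L2Line) η) :=
    (z.memLp 2 volume).integrable_mul (Lp.memLp (𝓕 v : L2Line))
  have hint : Integrable (Function.uncurry fun t η : ℝ =>
      φ t * ((Real.fourierChar (-(t * η)) : ℂ) * (z η * (𝓕 v : L2Line) η)))
      ((volume : Measure ℝ).prod volume) := by
    refine (hφ.mul_prod hvz).mono ?_ (ae_of_all _ fun x => ?_)
    · refine hφ.1.comp_fst.mul (AEStronglyMeasurable.mul ?_ hvz.1.comp_snd)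
      apply Continuous.aestronglyMeasurable
      exact continuous_subtype_val.comp (Real.continuous_fourierChar.comp (by fun_prop))
    · simp only [Function.uncurry, norm_mul, Circle.norm_coe, one_mul, le_refl]
  calc ∫ x, w x * convolution φ v (ContinuousLinearMap.mul ℂ ℂ) volume x
      = ∫ x, ∫ t, φ t * (v (x - t) * w x) := by
        refine integral_congr_ae (ae_of_all _ fun x => ?_)
        simp only [convolution, ContinuousLinearMap.mul_apply']
        rw [← integral_const_mul]
        refine integral_congr_ae (ae_of_all _ fun t => ?_)
        simp only; ring
    _ = ∫ t, ∫ x, φ t * (v (x - t) * w x) :=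
        integral_integral_swap (integrable_convolution_pairing hφ (Lp.memLp v) (w.memLp 2 volume))
    _ = ∫ t, ∫ η, φ t * ((Real.fourierChar (-(t * η)) : ℂ) * (z η * (𝓕 v : L2Line) η)) := by
        refine integral_congr_ae (ae_of_all _ fun t => ?_)
        simp only [integral_const_mul]
        rw [integral_comp_sub_mul_schwartz]
    _ = ∫ η, ∫ t, φ t * ((Real.fourierChar (-(t * η)) : ℂ) * (z η * (𝓕 v : L2Line) η)) :=
        integral_integral_swap hint
    _ = ∫ η, z η * (𝓕 (𝓕⁻ u) : L2Line) η := by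
        rw [FourierTransform.fourier_fourierInv_eq]
        refine integral_congr_ae ?_
        filter_upwards [mulOp_coeFn (fourierMultiplier φ hφ) (𝓕 v)] with η hη
        rw [hu, hη, fourierMultiplier_apply, Real.fourier_eq]
        simp only [← mul_assoc, integral_mul_const]
        rw [mul_assoc, mul_left_comm, mul_assoc]
        congr 2
        refine integral_congr_ae (ae_of_all _ fun t => ?_)
        simp only [Circle.smul_def, smul_eq_mul, RCLike.inner_apply, conj_trivial]
        rw [mul_comm, mul_comm t η]
    _ = ∫ x, w x * (𝓕⁻ u : L2Line) x := by
        rw [integral_schwartz_mul_fourier, hz, FourierTransform.fourier_fourierInv_eq]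

/-- The convolution theorem for `φ ∈ L¹` and `v ∈ L²`. -/
theorem convolution_ae_eq {φ : ℝ → ℂ} (hφ : Integrable φ) (v : L2Line) :
    convolution φ v (ContinuousLinearMap.mul ℂ ℂ) volume =ᵐ[volume]
      (𝓕⁻ (mulOp (fourierMultiplier φ hφ) (𝓕 v)) : L2Line) := by
  -- Smooth compactly supported test functions separate locally integrable functions, so the weak
  -- form is enough.
  refine ae_eq_of_integral_contDiff_smul_eq
    (locallyIntegrable_convolution hφ (Lp.memLp v))
    ((Lp.memLp _).locallyIntegrable (by norm_num)) fun g hg hgs => ?_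
  have hgs' : HasCompactSupport (fun x => (g x : ℂ)) := hgs.comp_left Complex.ofReal_zero
  have hg' : ContDiff ℝ (⊤ : ℕ∞) (fun x => (g x : ℂ)) := Complex.ofRealCLM.contDiff.comp hg
  have h := integral_convolution_mul_schwartz hφ v (hgs'.toSchwartzMap hg')
  simp only [Complex.real_smul]
  exact h

lemma fourier_toLp_convolution {φ : ℝ → ℂ} (hφ : Integrable φ) (v u : L2Line)
    (hu : u =ᵐ[volume] convolution φ v (ContinuousLinearMap.mul ℂ ℂ) volume) :
    (𝓕 u : L2Line) = mulOp (fourierMultiplier φ hφ) (𝓕 v) := by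
  have : u = 𝓕⁻ (mulOp (fourierMultiplier φ hφ) (𝓕 v)) :=
    Lp.ext (hu.trans (convolution_ae_eq hφ v))
  rw [this, FourierTransform.fourier_fourierInv_eq]

/-! ### The reflection -/

/-- The reflection `v ↦ v(-·)` of `L²(ℝ)`. -/
def reflection : L2Line →ₗᵢ[ℂ] L2Line :=
  Lp.compMeasurePreservingₗᵢ ℂ Neg.neg (Measure.measurePreserving_neg (volume : Measure ℝ))

lemma reflection_coeFn (v : L2Line) : reflection v =ᵐ[volume] fun x => v (-x) :=
  Lp.coeFn_compMeasurePreserving v (Measure.measurePreserving_neg (volume : Measure ℝ))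

/-- Both sides are continuous in v, so the substitution x ↦ -x on the dense set of Schwartz
functions suffices. -/
lemma fourier_reflection (v : L2Line) :
    (𝓕 (reflection v) : L2Line) = reflection (𝓕 v) := by
  refine DenseRange.induction_on
    (p := fun v : L2Line => (𝓕 (reflection v) : L2Line) = reflection (𝓕 v))
    (SchwartzMap.denseRange_toLpCLM (p := 2) (μ := (volume : Measure ℝ)) (F := ℂ)
      ENNReal.ofNat_ne_top) v ?_ ?_
  · exact isClosed_eq ((Lp.fourierTransformₗᵢ ℝ ℂ).continuous.comp reflection.continuous)
      (reflection.continuous.comp (Lp.fourierTransformₗᵢ ℝ ℂ).continuous)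
  · intro z
    rw [SchwartzMap.toLpCLM_apply]
    set z' := SchwartzMap.compCLMOfContinuousLinearEquiv ℂ (ContinuousLinearEquiv.neg ℝ) z with hz'
    have h1 : reflection (z.toLp 2) = z'.toLp 2 := by
      refine Lp.ext ?_
      have hq := (Measure.measurePreserving_neg (volume : Measure ℝ)).quasiMeasurePreserving
      filter_upwards [reflection_coeFn (z.toLp 2), z'.coeFn_toLp 2 volume,
        hq.ae (z.coeFn_toLp 2 volume)] with x h1 h2 h3
      rw [h1, h2]
      exact h3
    rw [h1, SchwartzMap.toLp_fourier_eq, SchwartzMap.toLp_fourier_eq]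
    refine Lp.ext ?_
    have hq := (Measure.measurePreserving_neg (volume : Measure ℝ)).quasiMeasurePreserving
    filter_upwards [reflection_coeFn ((𝓕 z).toLp 2), (𝓕 z').coeFn_toLp 2 volume,
      hq.ae ((𝓕 z).coeFn_toLp 2 volume)] with η h1 h2 h3
    rw [h1, h2]
    refine Eq.trans ?_ h3.symm
    rw [SchwartzMap.fourier_coe, SchwartzMap.fourier_coe, Real.fourier_eq, Real.fourier_eq,
      ← integral_neg_eq_self]
    refine integral_congr_ae (ae_of_all _ fun x => ?_)
    simp [hz']

/-! ### The Laplace transform on the Fourier side -/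

lemma integral_Ioi_eq_integral_exp (F : ℝ → ℂ) :
    ∫ x in Ioi (0 : ℝ), F x = ∫ u : ℝ, (Real.exp u : ℂ) * F (Real.exp u) := by
  have h := integral_image_eq_integral_abs_deriv_smul (s := univ) (f := Real.exp)
    (f' := Real.exp) MeasurableSet.univ (fun x _ => (Real.hasDerivAt_exp x).hasDerivWithinAt)
    Real.exp_injective.injOn F
  rw [image_univ, Real.range_exp, Measure.restrict_univ] at h
  simpa only [Real.abs_exp, Complex.real_smul] using h

lemma integrable_exp_mul_comp_exp {F : ℝ → ℂ} (hF : IntegrableOn F (Ioi (0 : ℝ))) :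
    Integrable fun u : ℝ => (Real.exp u : ℂ) * F (Real.exp u) := by
  have h := integrableOn_image_iff_integrableOn_abs_deriv_smul (s := univ) (f := Real.exp)
    (f' := Real.exp) MeasurableSet.univ (fun x _ => (Real.hasDerivAt_exp x).hasDerivWithinAt)
    Real.exp_injective.injOn F
  rw [image_univ, Real.range_exp, integrableOn_univ] at h
  simpa only [Real.abs_exp, Complex.real_smul] using h.1 hF

/-- The kernel `e^{t/2} exp(-e^t)` of the Laplace transform in logarithmic variables. -/
def laplaceKernel (t : ℝ) : ℂ := (Real.exp (t / 2) * Real.exp (-Real.exp t) : ℝ)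

/-- Under x = e^u the integrand of Γ(1/2 - 2πiη), with its Jacobian, is the Fourier character times
the Laplace kernel. Integrability and the transform of the kernel both follow. -/
lemma exp_mul_gamma_integrand (η u : ℝ) :
    (Real.exp u : ℂ) * ((Real.exp (-Real.exp u) : ℂ) *
      ((Real.exp u : ℝ) : ℂ) ^ ((1 / 2 - 2 * Real.pi * η * Complex.I : ℂ) - 1)) =
      Complex.exp (((-2 * Real.pi * u * η : ℝ) : ℂ) * Complex.I) * laplaceKernel u := by
  have hne : ((Real.exp u : ℝ) : ℂ) ≠ 0 := by exact_mod_cast (Real.exp_pos u).ne'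
  rw [Complex.cpow_sub _ _ hne, Complex.cpow_one, laplaceKernel,
    Complex.cpow_def_of_ne_zero hne, ← Complex.ofReal_log (Real.exp_pos u).le, Real.log_exp]
  have : Complex.exp (u * (1 / 2 - 2 * Real.pi * η * Complex.I)) =
      Complex.exp (((-2 * Real.pi * u * η : ℝ) : ℂ) * Complex.I) * (Real.exp (u / 2) : ℂ) := by
    rw [Complex.ofReal_exp, ← Complex.exp_add]
    congr 1; push_cast; ring
  rw [this]
  push_cast
  field_simp

lemma integrable_laplaceKernel : Integrable laplaceKernel := by
  have h := integrable_exp_mul_comp_exp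
    (Complex.GammaIntegral_convergent (s := 1 / 2 - 2 * Real.pi * (0 : ℝ) * Complex.I) (by simp))
  refine h.congr (ae_of_all _ fun u => ?_)
  simp only
  rw [exp_mul_gamma_integrand 0 u]
  simp

lemma fourier_laplaceKernel (η : ℝ) :
    𝓕 laplaceKernel η = Complex.Gamma (1 / 2 - 2 * Real.pi * η * Complex.I) := by
  rw [Complex.Gamma_eq_integral (by simp), Complex.GammaIntegral, integral_Ioi_eq_integral_exp,
    Real.fourier_real_eq_integral_exp_smul]
  refine integral_congr_ae (ae_of_all _ fun u => ?_)
  simp only [smul_eq_mul]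
  rw [exp_mul_gamma_integrand]

/-- The function `1 / cosh(2π²η)`. -/
def sechDecay (η : ℝ) : ℝ := (Real.cosh (2 * Real.pi ^ 2 * η))⁻¹

lemma continuous_sechDecay : Continuous sechDecay := by
  unfold sechDecay
  exact Continuous.inv₀ (by fun_prop) fun η => (Real.cosh_pos _).ne'

lemma sechDecay_pos (η : ℝ) : 0 < sechDecay η := inv_pos.2 (Real.cosh_pos _)

lemma sechDecay_le_one (η : ℝ) : sechDecay η ≤ 1 := inv_le_one_of_one_le₀ (Real.one_le_cosh _)

lemma sechDecay_neg (η : ℝ) : sechDecay (-η) = sechDecay η := by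
  simp [sechDecay]

lemma abs_mul_sechDecay_le {c : ℝ} (hc : 0 ≤ c) (η : ℝ) : |c * sechDecay η| ≤ c := by
  rw [abs_of_nonneg (mul_nonneg hc (sechDecay_pos η).le)]
  exact mul_le_of_le_one_right hc (sechDecay_le_one η)

/-- The multiplier `c / cosh(2π²η)`. -/
def sechMultiplier (c : ℝ) (hc : 0 ≤ c) : ℝ →ᵇ ℂ :=
  realMultiplier (fun η => c * sechDecay η) (continuous_const.mul continuous_sechDecay) c
    (abs_mul_sechDecay_le hc)

lemma sechMultiplier_apply (c : ℝ) (hc : 0 ≤ c) (η : ℝ) :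
    sechMultiplier c hc η = ((c * sechDecay η : ℝ) : ℂ) := rfl

/-- On Re z = 1/2 conjugation is z ↦ 1 - z, so |Γ(z)|² = Γ(z)Γ(1 - z) = π / sin(πz), and here the
sine is cosh(2π²η). -/
lemma star_mul_fourier_laplaceKernel :
    star (fourierMultiplier laplaceKernel integrable_laplaceKernel) *
      fourierMultiplier laplaceKernel integrable_laplaceKernel =
      sechMultiplier Real.pi Real.pi_pos.le := by
  ext η
  rw [BoundedContinuousFunction.mul_apply, BoundedContinuousFunction.star_apply,
    fourierMultiplier_apply, fourier_laplaceKernel, sechMultiplier_apply, mul_comm,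
    RCLike.star_def, ← Complex.Gamma_conj]
  have hconj : (starRingEnd ℂ) (1 / 2 - 2 * Real.pi * η * Complex.I) =
      1 - (1 / 2 - 2 * Real.pi * η * Complex.I) := by
    simp only [map_sub, map_mul, map_div₀, map_one, Complex.conj_ofReal, Complex.conj_I,
      map_ofNat]
    ring
  have hsin : Complex.sin (Real.pi * (1 / 2 - 2 * Real.pi * η * Complex.I)) =
      (Real.cosh (2 * Real.pi ^ 2 * η) : ℂ) := by
    rw [Complex.ofReal_cosh, ← Complex.cos_mul_I, ← Complex.sin_pi_div_two_sub]
    congr 1; push_cast; ring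
  rw [hconj, Complex.Gamma_mul_Gamma_one_sub, hsin, sechDecay]
  push_cast
  rfl

/-- With x = e^u and τ = e^v the factor e^{-xτ} depends only on u + v. This is a correlation;
reflecting one factor turns it into a convolution. -/
lemma logChange_laplace (f : L2Half) :
    logChange (laplace f) =ᵐ[volume] convolution laplaceKernel (reflection (logChange f))
      (ContinuousLinearMap.mul ℂ ℂ) volume := by
  have hL : (laplace f : ℝ → ℂ) =ᵐ[volume.restrict (Ioi (0 : ℝ))] laplaceFun f :=
    (memLp_laplaceFun f).coeFn_toLp
  filter_upwards [logChange_coeFn (laplace f), ae_comp_exp hL] with u h1 h2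
  rw [h1, h2, laplaceFun, integral_Ioi_eq_integral_exp, convolution,
    ← integral_const_mul]
  simp only [ContinuousLinearMap.mul_apply']
  -- Shifting the convolution variable by u puts the reflected function at -v.
  rw [← integral_add_right_eq_self (μ := volume)
    (fun t : ℝ => laplaceKernel t * (reflection (logChange f)) (u - t)) u]
  refine integral_congr_ae ?_
  have hr : ∀ᵐ v : ℝ, (reflection (logChange f)) (-v) = logChange f v := by
    have := (Measure.measurePreserving_neg (volume : Measure ℝ)).quasiMeasurePreserving.ae
      (reflection_coeFn (logChange f))
    simpa only [neg_neg] using this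
  filter_upwards [hr, logChange_coeFn f] with v h3 h4
  have e : u - (v + u) = -v := by ring
  rw [e, h3, h4, laplaceKernel]
  have e1 : Real.exp v = Real.exp (v / 2) * Real.exp (v / 2) := by
    rw [← Real.exp_add]; congr 1; ring
  have e2 : Real.exp ((v + u) / 2) = Real.exp (v / 2) * Real.exp (u / 2) := by
    rw [← Real.exp_add]; congr 1; ring
  rw [e2, ← Real.exp_add u v, add_comm u v]
  conv_lhs => rw [show ((Real.exp v : ℝ) : ℂ) = ((Real.exp (v / 2) * Real.exp (v / 2) : ℝ) : ℂ) by
    rw [← e1]]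
  push_cast
  ring

lemma fourierLog_laplace (f : L2Half) :
    fourierLog (laplace f) = mulOp (fourierMultiplier laplaceKernel integrable_laplaceKernel)
      (reflection (fourierLog f)) := by
  rw [fourierLog_apply, fourierLog_apply, ← fourier_reflection]
  exact fourier_toLp_convolution integrable_laplaceKernel _ _ (logChange_laplace f)

/-- Since cosh is even, the multiplier passes through the reflection; this lets the two reflections
in L*L cancel. -/
lemma mulOp_reflection (c : ℝ) (hc : 0 ≤ c) (v : L2Line) :
    mulOp (sechMultiplier c hc) (reflection v) = reflection (mulOp (sechMultiplier c hc) v) := by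
  refine Lp.ext ?_
  have hq := (Measure.measurePreserving_neg (volume : Measure ℝ)).quasiMeasurePreserving
  filter_upwards [mulOp_coeFn (sechMultiplier c hc) (reflection v), reflection_coeFn v,
    reflection_coeFn (mulOp (sechMultiplier c hc) v),
    hq.ae (mulOp_coeFn (sechMultiplier c hc) v)] with x h1 h2 h3 h4
  rw [h1, h2, h3, h4, sechMultiplier_apply, sechMultiplier_apply, sechDecay_neg]

/-- `L* L` is multiplication by `π / cosh(2π²η)` after the unitary operator `𝓕 V`. -/
theorem fourierLog_adjoint_laplace (f : L2Half) :
    fourierLog (ContinuousLinearMap.adjoint laplace (laplace f)) =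
      mulOp (sechMultiplier Real.pi Real.pi_pos.le) (fourierLog f) := by
  -- The comparison is made in weak form, through ⟨Lg, Lf⟩, where each L contributes its Gamma
  -- multiplier and a reflection.
  refine ext_inner_left ℂ fun v => ?_
  obtain ⟨g, rfl⟩ := fourierLog.surjective v
  rw [LinearIsometryEquiv.inner_map_map, ContinuousLinearMap.adjoint_inner_right,
    ← fourierLog.inner_map_map, fourierLog_laplace, fourierLog_laplace,
    ← ContinuousLinearMap.adjoint_inner_right, ← ContinuousLinearMap.star_eq_adjoint,
    ← mulOp_star]
  have h : ∀ m n v, mulOp m (mulOp n v) = mulOp (m * n) v := fun m n v => by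
    rw [mulOp_mul]; rfl
  rw [h, star_mul_fourier_laplaceKernel, mulOp_reflection, LinearIsometry.inner_map_map]

/-! ### The source operator on the Fourier side -/

lemma continuousOn_logSource {p : ℝ} (hp : 0 < p) :
    ContinuousOn (logSource p) (Icc 0 (Real.exp 1)⁻¹) := by
  intro t ht
  refine ContinuousAt.continuousWithinAt ?_
  rcases ht.1.eq_or_lt with h0 | h0
  · subst h0
    rw [continuousAt_iff_punctured_nhds]
    have h1 : Tendsto (fun t : ℝ => -Real.log t) (𝓝[≠] 0) atTop :=
      tendsto_neg_atBot_atTop.comp Real.tendsto_log_nhdsNE_zero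
    have h2 := (tendsto_rpow_neg_atTop hp).comp h1
    -- The conventions `Real.log 0 = 0` and `0 ^ (-p) = 0` give the value that agrees with the limit
    -- at 0.
    have h3 : logSource p 0 = 0 := by
      rw [logSource, Real.log_zero, neg_zero, Real.zero_rpow (neg_ne_zero.2 hp.ne')]
    rw [h3]
    exact h2
  · have hlog : Real.log t < 0 :=
      Real.log_neg h0 (ht.2.trans_lt (inv_lt_one_of_one_lt₀ (Real.one_lt_exp_iff.2 one_pos)))
    exact ((Real.continuousAt_log h0.ne').neg).rpow_const (Or.inl (neg_pos.2 hlog).ne')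

lemma adjoint_comp_normalizedLaplace (f : L2Half) :
    (ContinuousLinearMap.adjoint normalizedLaplace ∘L normalizedLaplace) f =
      (((Real.pi * Real.exp 1)⁻¹ : ℝ) : ℂ) • ContinuousLinearMap.adjoint laplace (laplace f) := by
  have hadj : ContinuousLinearMap.adjoint normalizedLaplace =
      ((√(Real.pi * Real.exp 1))⁻¹ : ℂ) • ContinuousLinearMap.adjoint laplace := by
    rw [normalizedLaplace, map_smulₛₗ]
    simp
  rw [ContinuousLinearMap.comp_apply, hadj, normalizedLaplace]
  change ((√(Real.pi * Real.exp 1))⁻¹ : ℂ) • ContinuousLinearMap.adjoint laplace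
    (((√(Real.pi * Real.exp 1))⁻¹ : ℂ) • laplace f) = _
  rw [map_smul, smul_smul]
  congr 1
  rw [← Complex.ofReal_inv, ← Complex.ofReal_mul, ← mul_inv,
    Real.mul_self_sqrt (by positivity)]

lemma fourierLog_adjoint_comp_normalizedLaplace (f : L2Half) :
    fourierLog ((ContinuousLinearMap.adjoint normalizedLaplace ∘L normalizedLaplace) f) =
      mulOp (sechMultiplier (Real.exp 1)⁻¹ (by positivity)) (fourierLog f) := by
  rw [adjoint_comp_normalizedLaplace, map_smul, fourierLog_adjoint_laplace]
  refine Lp.ext ?_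
  filter_upwards [Lp.coeFn_smul (((Real.pi * Real.exp 1)⁻¹ : ℝ) : ℂ)
      (mulOp (sechMultiplier Real.pi Real.pi_pos.le) (fourierLog f)),
    mulOp_coeFn (sechMultiplier Real.pi Real.pi_pos.le) (fourierLog f),
    mulOp_coeFn (sechMultiplier (Real.exp 1)⁻¹ (by positivity)) (fourierLog f)] with η h1 h2 h3
  rw [h1, h3, Pi.smul_apply, h2, sechMultiplier_apply, sechMultiplier_apply, smul_eq_mul,
    ← mul_assoc, ← Complex.ofReal_mul]
  congr 2
  have := Real.pi_ne_zero
  field_simp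

/-- The weight `1 + ln cosh(2π²η)`. -/
def logWeight (η : ℝ) : ℝ := 1 + Real.log (Real.cosh (2 * Real.pi ^ 2 * η))

lemma continuous_logWeight : Continuous logWeight := by
  unfold logWeight
  exact continuous_const.add (Continuous.log (by fun_prop) fun η => (Real.cosh_pos _).ne')

lemma one_le_logWeight (η : ℝ) : 1 ≤ logWeight η :=
  le_add_of_nonneg_right (Real.log_nonneg (Real.one_le_cosh _))

lemma logWeight_pos (η : ℝ) : 0 < logWeight η := one_pos.trans_le (one_le_logWeight η)

lemma cosh_le_exp_abs (x : ℝ) : Real.cosh x ≤ Real.exp |x| := by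
  rw [← Real.cosh_abs, Real.cosh_eq]
  have : Real.exp (-|x|) ≤ Real.exp |x| := Real.exp_le_exp.2 (by linarith [abs_nonneg x])
  linarith

lemma exp_abs_le_two_mul_cosh (x : ℝ) : Real.exp |x| ≤ 2 * Real.cosh x := by
  rw [← Real.cosh_abs x, Real.cosh_eq]
  linarith [Real.exp_pos (-|x|)]

lemma logWeight_le (η : ℝ) : logWeight η ≤ 1 + 2 * Real.pi ^ 2 * |η| := by
  have h := Real.log_le_log (Real.cosh_pos _) (cosh_le_exp_abs (2 * Real.pi ^ 2 * η))
  rw [Real.log_exp, abs_mul, abs_of_pos (by positivity : 0 < 2 * Real.pi ^ 2)] at h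
  unfold logWeight
  linarith

/-- From e^{|x|} ≤ 2 cosh x only ln 2 is lost, and the summand 1 of the weight absorbs it. -/
lemma le_logWeight (η : ℝ) : 2 * Real.pi ^ 2 * |η| ≤ logWeight η := by
  have h := Real.log_le_log (Real.exp_pos _) (exp_abs_le_two_mul_cosh (2 * Real.pi ^ 2 * η))
  rw [Real.log_exp, abs_mul, abs_of_pos (by positivity : 0 < 2 * Real.pi ^ 2),
    Real.log_mul two_ne_zero (Real.cosh_pos _).ne'] at h
  unfold logWeight
  linarith [Real.log_two_lt_d9]

/-- The normalization by πe is what produces the summand 1 in the weight and keeps the weight away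
from zero. -/
lemma logSource_sechDecay (p η : ℝ) :
    logSource p ((Real.exp 1)⁻¹ * sechDecay η) = logWeight η ^ (-p) := by
  rw [logSource, Real.log_mul (by positivity) (sechDecay_pos η).ne', Real.log_inv, Real.log_exp,
    sechDecay, Real.log_inv, logWeight]
  congr 1
  ring

theorem fourierLog_sourceOperator {p : ℝ} (hp : 0 < p) (f : L2Half) :
    fourierLog (sourceOperator p f) =ᵐ[volume]
      fun η => ((logWeight η ^ (-p) : ℝ) : ℂ) * fourierLog f η := by
  have h := cfc_conj_mulOp fourierLog (logSource p) (fun η => (Real.exp 1)⁻¹ * sechDecay η)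
    (continuous_const.mul continuous_sechDecay) (Real.exp 1)⁻¹
    (abs_mul_sechDecay_le (by positivity)) (a := 0) (b := (Real.exp 1)⁻¹)
    (fun η => ⟨mul_nonneg (by positivity) (sechDecay_pos η).le,
      mul_le_of_le_one_right (by positivity) (sechDecay_le_one η)⟩)
    (continuousOn_logSource hp) _ fourierLog_adjoint_comp_normalizedLaplace f
  simp only [logSource_sechDecay] at h
  exact h

/-! ### Sobolev spaces -/

lemma japanese_le_logWeight (η : ℝ) :
    (1 + (2 * Real.pi * η) ^ 2) ^ (1 / 2 : ℝ) ≤ 2 * logWeight η := by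
  rw [← Real.sqrt_eq_rpow]
  refine Real.sqrt_le_iff.2 ⟨by linarith [logWeight_pos η], ?_⟩
  have h1 := one_le_logWeight η
  have h2 := le_logWeight η
  have h3 : 2 * Real.pi * |η| ≤ logWeight η := by
    refine le_trans ?_ h2
    have : Real.pi ≤ Real.pi ^ 2 := by nlinarith [Real.pi_gt_three]
    gcongr
  have h4 : (2 * Real.pi * η) ^ 2 = (2 * Real.pi * |η|) ^ 2 := by
    rw [mul_pow, mul_pow _ |η|, sq_abs]
  rw [h4]
  have h5 : (2 * Real.pi * |η|) ^ 2 ≤ logWeight η ^ 2 := by gcongr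
  nlinarith

lemma logWeight_le_japanese (η : ℝ) :
    logWeight η ≤ 2 * Real.pi * (1 + (2 * Real.pi * η) ^ 2) ^ (1 / 2 : ℝ) := by
  rw [← Real.sqrt_eq_rpow]
  set r := √(1 + (2 * Real.pi * η) ^ 2) with hr
  have h1 : 1 ≤ r := Real.one_le_sqrt.2 (by nlinarith [sq_nonneg (2 * Real.pi * η)])
  have h2 : 2 * Real.pi * |η| ≤ r := by
    refine Real.le_sqrt_of_sq_le ?_
    rw [mul_pow, sq_abs, ← mul_pow]
    linarith
  have h3 := logWeight_le η
  have h4 : 2 * Real.pi ^ 2 * |η| ≤ Real.pi * r := by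
    calc 2 * Real.pi ^ 2 * |η| = Real.pi * (2 * Real.pi * |η|) := by ring
      _ ≤ _ := by gcongr
  nlinarith [Real.pi_gt_three]

/-- `MemHp` weights by 1 + |η|² without the factor 2π of `sobolevNorm`, hence a comparison of its
own. -/
lemma logWeight_le_bessel (η : ℝ) :
    logWeight η ≤ 4 * Real.pi ^ 2 * (1 + ‖η‖ ^ 2) ^ (1 / 2 : ℝ) := by
  rw [← Real.sqrt_eq_rpow]
  set r := √(1 + ‖η‖ ^ 2) with hr
  have h1 : 1 ≤ r := Real.one_le_sqrt.2 (by nlinarith [sq_nonneg ‖η‖])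
  have h2 : |η| ≤ r := Real.le_sqrt_of_sq_le (by rw [Real.norm_eq_abs]; linarith)
  have h3 := logWeight_le η
  have h4 : 2 * Real.pi ^ 2 * |η| ≤ 2 * Real.pi ^ 2 * r := by gcongr
  nlinarith [Real.pi_gt_three, mul_nonneg (sq_nonneg Real.pi) (by linarith : 0 ≤ r)]

lemma rpow_le_of_le_mul_rpow_half {a b c p : ℝ} (ha : 0 ≤ a) (hb : 0 ≤ b) (hc : 0 ≤ c)
    (hp : 0 < p) (h : a ≤ c * b ^ (1 / 2 : ℝ)) : a ^ p ≤ c ^ p * b ^ (p / 2) := by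
  calc a ^ p ≤ (c * b ^ (1 / 2 : ℝ)) ^ p := Real.rpow_le_rpow ha h hp.le
    _ = _ := by
      rw [Real.mul_rpow hc (by positivity), ← Real.rpow_mul hb]
      congr 2; ring

/-- Membership provides an L² function equal to the weighted transform as a distribution; testing
against smooth compactly supported functions makes the equality pointwise almost everywhere. -/
lemma memLp_bessel_mul_fourier {p : ℝ} {v : L2Line} (hv : MemHp p v) :
    MemLp (fun η : ℝ => (((1 + ‖η‖ ^ 2) ^ (p / 2) : ℝ) : ℂ) * (𝓕 v : L2Line) η) 2 volume := by
  obtain ⟨f', hf'⟩ := TemperedDistribution.memSobolev_iff_exists_smulLeftCLM_fourier.1 hv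
  have hT : Function.HasTemperateGrowth
      (fun η : ℝ => (((1 + ‖η‖ ^ 2) ^ (p / 2) : ℝ) : ℂ)) := by fun_prop
  have hcont : Continuous (fun η : ℝ => (((1 + ‖η‖ ^ 2) ^ (p / 2) : ℝ) : ℂ)) :=
    Complex.continuous_ofReal.comp
      (Continuous.rpow_const (by fun_prop) fun η => Or.inl (by positivity))
  rw [Lp.fourier_toTemperedDistribution_eq] at hf'
  refine (memLp_congr_ae ?_).1 (Lp.memLp f')
  refine ae_eq_of_integral_contDiff_smul_eq ((Lp.memLp f').locallyIntegrable (by norm_num))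
    (((Lp.memLp (𝓕 v : L2Line)).locallyIntegrable (by norm_num)).continuous_smul hcont)
    fun g hg hgs => ?_
  have hgs' : HasCompactSupport (fun x => (g x : ℂ)) := hgs.comp_left Complex.ofReal_zero
  have hg' : ContDiff ℝ (⊤ : ℕ∞) (fun x => (g x : ℂ)) := Complex.ofRealCLM.contDiff.comp hg
  have h := congrArg (fun T : 𝓢'(ℝ, ℂ) => T (hgs'.toSchwartzMap hg')) hf'
  simp only [TemperedDistribution.smulLeftCLM_apply_apply, Lp.toTemperedDistribution_apply,
    SchwartzMap.smulLeftCLM_apply_apply hT, smul_eq_mul] at h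
  simp only [Complex.real_smul]
  refine Eq.trans h.symm (integral_congr_ae (ae_of_all _ fun x => ?_))
  change _ * (g x : ℂ) * _ = (g x : ℂ) * _
  ring

lemma memLp_logWeight_mul_fourier {p : ℝ} (hp : 0 < p) {v : L2Line} (hv : MemHp p v) :
    MemLp (fun η : ℝ => ((logWeight η ^ p : ℝ) : ℂ) * (𝓕 v : L2Line) η) 2 volume := by
  refine (memLp_bessel_mul_fourier hv).of_le_mul (c := (4 * Real.pi ^ 2) ^ p) ?_
    (ae_of_all _ fun η => ?_)
  · refine AEStronglyMeasurable.mul ?_ (Lp.memLp _).1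
    exact (Complex.continuous_ofReal.comp (continuous_logWeight.rpow_const
      fun η => Or.inl (logWeight_pos η).ne')).aestronglyMeasurable
  · rw [norm_mul, norm_mul, ← mul_assoc, Complex.norm_real, Complex.norm_real,
      Real.norm_of_nonneg (by have := logWeight_pos η; positivity),
      Real.norm_of_nonneg (by positivity)]
    gcongr
    exact rpow_le_of_le_mul_rpow_half (logWeight_pos η).le (by positivity) (by positivity) hp
      (logWeight_le_bessel η)

lemma eLpNorm_ofReal_mul_le {a b : ℝ → ℝ} {c : ℝ} (hc : 0 ≤ c) (ha : ∀ η, 0 ≤ a η)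
    (hab : ∀ η, a η ≤ c * b η) (F : ℝ → ℂ) :
    eLpNorm (fun η => (a η : ℂ) * F η) 2 volume ≤
      ENNReal.ofReal c * eLpNorm (fun η => (b η : ℂ) * F η) 2 volume := by
  refine eLpNorm_le_mul_eLpNorm_of_ae_le_mul (ae_of_all _ fun η => ?_) 2
  rw [norm_mul, norm_mul, ← mul_assoc, Complex.norm_real, Complex.norm_real,
    Real.norm_of_nonneg (ha η)]
  gcongr
  exact (hab η).trans (mul_le_mul_of_nonneg_left (Real.le_norm_self _) hc)

lemma enorm_eq_eLpNorm_of_ae_eq {w : L2Half} {F : ℝ → ℂ} (h : fourierLog w =ᵐ[volume] F) :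
    ENNReal.ofReal ‖w‖ = eLpNorm F 2 volume := by
  rw [← fourierLog.norm_map, Lp.norm_def, ENNReal.ofReal_toReal (Lp.memLp _).2.ne,
    eLpNorm_congr_ae h]

/-- Sobolev smoothness of `V f` is the logarithmic source condition, with equivalent norms. -/
theorem exists_source_of_memHp {p : ℝ} (hp : 0 < p) {f : L2Half} (hf : MemHp p (logChange f)) :
    ∃ w : L2Half, (∀ w' : L2Half, sourceOperator p w' = f ↔ w' = w) ∧
      ENNReal.ofReal (((2 * Real.pi) ^ p)⁻¹ * ‖w‖) ≤ sobolevNorm p (logChange f) ∧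
      sobolevNorm p (logChange f) ≤ ENNReal.ofReal (2 ^ p * ‖w‖) ∧
      fourierLog f =ᵐ[volume] fun η => ((logWeight η ^ (-p) : ℝ) : ℂ) * fourierLog w η := by
  -- The source operator divides by Λ^p on the Fourier side, so Λ^p 𝓕(Vf) is the only candidate for
  -- 𝓕(Vw).
  set W := (memLp_logWeight_mul_fourier hp hf).toLp _ with hW
  have hWc : W =ᵐ[volume] fun η => ((logWeight η ^ p : ℝ) : ℂ) * fourierLog f η :=
    (memLp_logWeight_mul_fourier hp hf).coeFn_toLp
  have hw : fourierLog (fourierLog.symm W) =ᵐ[volume]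
      fun η => ((logWeight η ^ p : ℝ) : ℂ) * fourierLog f η := by
    rw [LinearIsometryEquiv.apply_symm_apply]; exact hWc
  have hcancel : ∀ η (z : ℂ),
      ((logWeight η ^ (-p) : ℝ) : ℂ) * (((logWeight η ^ p : ℝ) : ℂ) * z) = z := fun η z => by
    rw [← mul_assoc, ← Complex.ofReal_mul, ← Real.rpow_add (logWeight_pos η), neg_add_cancel,
      Real.rpow_zero, Complex.ofReal_one, one_mul]
  have hsrc : fourierLog f =ᵐ[volume]
      fun η => ((logWeight η ^ (-p) : ℝ) : ℂ) * fourierLog (fourierLog.symm W) η := by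
    filter_upwards [hw] with η h
    rw [h, hcancel]
  have hinj : ∀ w₁ w₂ : L2Half, sourceOperator p w₁ = sourceOperator p w₂ → w₁ = w₂ := by
    intro w₁ w₂ h
    apply fourierLog.injective
    refine Lp.ext ?_
    filter_upwards [fourierLog_sourceOperator hp w₁, fourierLog_sourceOperator hp w₂] with η h1 h2
    rw [h, h2] at h1
    refine mul_left_cancel₀ ?_ h1.symm
    exact_mod_cast (Real.rpow_pos_of_pos (logWeight_pos η) _).ne'
  have hsol : sourceOperator p (fourierLog.symm W) = f := by
    apply fourierLog.injective
    exact Lp.ext ((fourierLog_sourceOperator hp _).trans hsrc.symm)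
  have hnorm := enorm_eq_eLpNorm_of_ae_eq hw
  have hpos : ∀ η, 0 ≤ logWeight η ^ p := fun η => Real.rpow_nonneg (logWeight_pos η).le _
  refine ⟨fourierLog.symm W, fun w' => ⟨fun h => hinj _ _ (h.trans hsol.symm), fun h => h ▸ hsol⟩,
    ?_, ?_, hsrc⟩
  · have h := eLpNorm_ofReal_mul_le (c := (2 * Real.pi) ^ p) (by positivity) hpos
      (fun η => rpow_le_of_le_mul_rpow_half (logWeight_pos η).le (by positivity)
        (by positivity) hp (logWeight_le_japanese η)) (fourierLog f)
    rw [ENNReal.ofReal_mul (by positivity), hnorm]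
    refine (mul_le_mul_right h _).trans ?_
    rw [← mul_assoc, ← ENNReal.ofReal_mul (by positivity), inv_mul_cancel₀ (by positivity),
      ENNReal.ofReal_one, one_mul]
    exact le_rfl
  · rw [ENNReal.ofReal_mul (by positivity), hnorm]
    refine eLpNorm_ofReal_mul_le (a := fun η => (1 + (2 * Real.pi * η) ^ 2) ^ (p / 2))
      (by positivity) (fun η => by positivity) (fun η => ?_) _
    calc (1 + (2 * Real.pi * η) ^ 2) ^ (p / 2)
        = ((1 + (2 * Real.pi * η) ^ 2) ^ (1 / 2 : ℝ)) ^ p := by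
          rw [← Real.rpow_mul (by positivity)]; congr 1; ring
      _ ≤ (2 * logWeight η) ^ p := by
          gcongr
          exact japanese_le_logWeight η
      _ = _ := Real.mul_rpow (by norm_num) (logWeight_pos η).le

/-! ### The symbol of the mollifier -/

/-- The function `1 - √(2π) φ̂(2πη)`. -/
def mollifierDefect (φ : ℝ → ℂ) (η : ℝ) : ℝ :=
  1 - √(2 * Real.pi) * (unitaryFourier φ (2 * Real.pi * η)).re

lemma fourier_eq_unitaryFourier (φ : ℝ → ℂ) (η : ℝ) :
    𝓕 φ η = (√(2 * Real.pi) : ℂ) * unitaryFourier φ (2 * Real.pi * η) := by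
  have hne : (√(2 * Real.pi) : ℂ) ≠ 0 := by
    exact_mod_cast (Real.sqrt_pos.2 Real.two_pi_pos).ne'
  rw [unitaryFourier, mul_inv_cancel_left₀ hne, Real.fourier_real_eq_integral_exp_smul]
  refine integral_congr_ae (ae_of_all _ fun t => ?_)
  simp only [smul_eq_mul]
  congr 2
  push_cast
  ring

lemma integrable_dilate {φ : ℝ → ℂ} (hφ : Integrable φ) {β : ℝ} (hβ : 0 < β) :
    Integrable (dilate φ β) :=
  (hφ.comp_div hβ.ne').const_mul _

lemma fourier_dilate (φ : ℝ → ℂ) {β : ℝ} (hβ : 0 < β) (η : ℝ) :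
    𝓕 (dilate φ β) η = 𝓕 φ (β * η) := by
  have hβc : (β : ℂ) ≠ 0 := by exact_mod_cast hβ.ne'
  rw [Real.fourier_real_eq_integral_exp_smul, Real.fourier_real_eq_integral_exp_smul]
  have h := Measure.integral_comp_div (fun v : ℝ =>
    Complex.exp (((-2 * Real.pi * v * (β * η) : ℝ) : ℂ) * Complex.I) • φ v) β
  rw [abs_of_pos hβ] at h
  have h2 : ∫ v : ℝ, Complex.exp (((-2 * Real.pi * v * η : ℝ) : ℂ) * Complex.I) • dilate φ β v =
      (β⁻¹ : ℂ) * ∫ v : ℝ, Complex.exp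
        (((-2 * Real.pi * (v / β) * (β * η) : ℝ) : ℂ) * Complex.I) • φ (v / β) := by
    rw [← integral_const_mul]
    refine integral_congr_ae (ae_of_all _ fun t => ?_)
    simp only [dilate, smul_eq_mul]
    have e : -2 * Real.pi * (t / β) * (β * η) = -2 * Real.pi * t * η := by
      have := hβ.ne'
      field_simp
    rw [e]
    ring
  rw [h2, h, Complex.real_smul, inv_mul_cancel_left₀ hβc]

section Mollifier

variable {φ : ℝ → ℂ} {s : ℝ}

lemma IsMollifier.fourier_eq (hφ : IsMollifier φ s) (η : ℝ) :
    𝓕 φ η = ((1 - mollifierDefect φ η : ℝ) : ℂ) := by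
  rw [fourier_eq_unitaryFourier, mollifierDefect, sub_sub_cancel, Complex.ofReal_mul]
  congr 1
  exact Complex.ext rfl (by simp [hφ.real_valued])

lemma IsMollifier.continuous_defect (hφ : IsMollifier φ s) : Continuous (mollifierDefect φ) := by
  have h : mollifierDefect φ = fun η => 1 - (fourierMultiplier φ hφ.integrable η).re := by
    funext η
    rw [fourierMultiplier_apply, hφ.fourier_eq, Complex.ofReal_re, sub_sub_cancel]
  rw [h]
  exact continuous_const.sub
    (Complex.continuous_re.comp (fourierMultiplier φ hφ.integrable).continuous)

lemma IsMollifier.defect_zero (hφ : IsMollifier φ s) : mollifierDefect φ 0 = 0 := by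
  have h := hφ.fourier_eq 0
  have h1 : 𝓕 φ 0 = 1 := by
    rw [Real.fourier_real_eq_integral_exp_smul, ← hφ.integral_eq_one]
    simp
  rw [h1] at h
  have : (1 : ℝ) = 1 - mollifierDefect φ 0 := by exact_mod_cast h
  linarith

lemma IsMollifier.defect_pos (hφ : IsMollifier φ s) {η : ℝ} (hη : η ≠ 0) :
    0 < mollifierDefect φ η := by
  have h := hφ.lt_max (2 * Real.pi * η) (mul_ne_zero Real.two_pi_pos.ne' hη)
  have hpos := Real.sqrt_pos.2 Real.two_pi_pos
  rw [lt_div_iff₀ hpos] at h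
  unfold mollifierDefect
  linarith

lemma IsMollifier.defect_nonneg (hφ : IsMollifier φ s) (η : ℝ) : 0 ≤ mollifierDefect φ η := by
  rcases eq_or_ne η 0 with rfl | h
  · exact hφ.defect_zero.ge
  · exact (hφ.defect_pos h).le

lemma IsMollifier.defect_mono (hφ : IsMollifier φ s) {ξ η : ℝ} (h : |ξ| ≤ |η|) :
    mollifierDefect φ ξ ≤ mollifierDefect φ η := by
  have h1 := hφ.decreasing (2 * Real.pi * ξ) (2 * Real.pi * η) (by
    rw [abs_mul, abs_mul _ η]; gcongr)
  unfold mollifierDefect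
  gcongr

lemma IsMollifier.defect_le (hφ : IsMollifier φ s) (η : ℝ) :
    mollifierDefect φ η ≤ 1 + ‖fourierMultiplier φ hφ.integrable‖ := by
  have h := (fourierMultiplier φ hφ.integrable).norm_coe_le_norm η
  rw [fourierMultiplier_apply, hφ.fourier_eq, Complex.norm_real, Real.norm_eq_abs] at h
  linarith [neg_abs_le (1 - mollifierDefect φ η)]

/-- Near zero the defect is comparable to `|2πη|^s`. -/
lemma IsMollifier.exists_defect_bounds (hφ : IsMollifier φ s) (hs : 0 < s) :
    ∃ r > 0, ∀ η : ℝ, |η| ≤ r → 1 / 2 * |2 * Real.pi * η| ^ s ≤ mollifierDefect φ η ∧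
      mollifierDefect φ η ≤ 2 * |2 * Real.pi * η| ^ s := by
  -- A relative error of 1/2 gives the factors 1/2 and 3/2; the latter is relaxed to 2.
  have h := hφ.equivalent.isLittleO.def (c := 1 / 2) (by norm_num)
  rw [eventually_nhdsWithin_iff, Metric.eventually_nhds_iff] at h
  obtain ⟨r, hr, h⟩ := h
  -- This radius gives |2πη| ≤ r/2, strictly inside the neighbourhood.
  refine ⟨r / (4 * Real.pi), by positivity, fun η hη => ?_⟩
  rcases eq_or_ne η 0 with rfl | h0
  · simp [hφ.defect_zero, Real.zero_rpow hs.ne']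
  have hd : dist (2 * Real.pi * η) 0 < r := by
    rw [Real.dist_eq, sub_zero, abs_mul, abs_of_pos Real.two_pi_pos]
    rw [le_div_iff₀ (by positivity)] at hη
    nlinarith
  have h1 := h hd (mul_ne_zero Real.two_pi_pos.ne' h0)
  have h2 : ‖1 - (√(2 * Real.pi) : ℂ) * unitaryFourier φ ((2 * Real.pi * η : ℝ) : ℝ)‖ =
      mollifierDefect φ η := by
    rw [← fourier_eq_unitaryFourier, hφ.fourier_eq, ← Complex.ofReal_one, ← Complex.ofReal_sub,
      sub_sub_cancel, Complex.norm_real, Real.norm_of_nonneg (hφ.defect_nonneg η)]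
  have hx : 0 ≤ |2 * Real.pi * η| ^ s := by positivity
  rw [Pi.sub_apply, h2, Real.norm_eq_abs, Real.norm_of_nonneg hx, abs_le] at h1
  constructor <;> linarith

/-- The symbol of `I - C_β` after the Fourier transform. -/
def IsMollifier.defectMultiplier (hφ : IsMollifier φ s) (β : ℝ) : ℝ →ᵇ ℂ :=
  realMultiplier (fun η => mollifierDefect φ (β * η))
    (hφ.continuous_defect.comp (continuous_const.mul continuous_id))
    (1 + ‖fourierMultiplier φ hφ.integrable‖) fun η => by
      rw [abs_of_nonneg (hφ.defect_nonneg _)]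
      exact hφ.defect_le _

/-- The convolution theorem identifies the symbol of I - C_β, and Plancherel carries the norm over.
-/
lemma IsMollifier.enorm_defectMultiplier (hφ : IsMollifier φ s) {β : ℝ} (hβ : 0 < β)
    (f : L2Half) :
    eLpNorm (fun u => logChange f u - mollify φ β (logChange f) u) 2 volume =
      ‖mulOp (hφ.defectMultiplier β) (fourierLog f)‖ₑ := by
  set v := logChange f with hv
  set m := fourierMultiplier (dilate φ β) (integrable_dilate hφ.integrable hβ) with hm
  set u : L2Line := 𝓕⁻ (mulOp m (𝓕 v)) with hu
  have h1 : (fun x => v x - mollify φ β v x) =ᵐ[volume] (v - u : L2Line) := by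
    filter_upwards [convolution_ae_eq (integrable_dilate hφ.integrable hβ) v,
      Lp.coeFn_sub v u] with x h1 h2
    rw [h2, Pi.sub_apply]
    congr 1
  rw [eLpNorm_congr_ae h1, ← Lp.enorm_def, ← ofReal_norm, ← ofReal_norm]
  congr 1
  rw [← Lp.norm_fourier_eq]
  congr 1
  have h2 : (𝓕 (v - u) : L2Line) = 𝓕 v - 𝓕 u := (Lp.fourierTransformₗᵢ ℝ ℂ).map_sub v u
  rw [h2, hu, FourierTransform.fourier_fourierInv_eq, fourierLog_apply]
  refine Lp.ext ?_
  filter_upwards [Lp.coeFn_sub (𝓕 v : L2Line) (mulOp m (𝓕 v)), mulOp_coeFn m (𝓕 v),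
    mulOp_coeFn (hφ.defectMultiplier β) (𝓕 v)] with η h1 h2 h3
  rw [h1, h3, Pi.sub_apply, h2, hm, fourierMultiplier_apply, fourier_dilate φ hβ, hφ.fourier_eq,
    IsMollifier.defectMultiplier, realMultiplier_apply]
  push_cast
  ring

/-! ### The minimizer -/

/-- The symbol `π / cosh(2π²η) + (1 - √(2π) φ̂(2πβη))²` of the normal equation. -/
def normalSymbol (φ : ℝ → ℂ) (β η : ℝ) : ℝ :=
  Real.pi * sechDecay η + mollifierDefect φ (β * η) ^ 2

lemma sechDecay_anti {ξ η : ℝ} (h : |ξ| ≤ |η|) : sechDecay η ≤ sechDecay ξ := by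
  refine inv_anti₀ (Real.cosh_pos _) (Real.cosh_le_cosh.2 ?_)
  rw [abs_mul, abs_mul _ η]
  gcongr

/-- For |η| ≤ 1 the Laplace symbol is bounded below; for |η| ≥ 1 monotonicity bounds the defect
below by its value at β, which is positive. -/
lemma IsMollifier.exists_le_normalSymbol (hφ : IsMollifier φ s) {β : ℝ} (hβ : 0 < β) :
    ∃ γ > 0, ∀ η, γ ≤ normalSymbol φ β η := by
  have h1 : 0 < Real.pi * sechDecay 1 := mul_pos Real.pi_pos (sechDecay_pos 1)
  have h2 : 0 < mollifierDefect φ β ^ 2 := pow_pos (hφ.defect_pos hβ.ne') 2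
  refine ⟨min (Real.pi * sechDecay 1) (mollifierDefect φ β ^ 2), lt_min h1 h2, fun η => ?_⟩
  have h3 : 0 ≤ Real.pi * sechDecay η := (mul_pos Real.pi_pos (sechDecay_pos η)).le
  unfold normalSymbol
  rcases le_total |η| 1 with h | h
  · have : sechDecay 1 ≤ sechDecay η := sechDecay_anti (by simpa using h)
    have := mul_le_mul_of_nonneg_left this Real.pi_pos.le
    have := min_le_left (Real.pi * sechDecay 1) (mollifierDefect φ β ^ 2)
    nlinarith [sq_nonneg (mollifierDefect φ (β * η))]
  · have h4 : mollifierDefect φ β ≤ mollifierDefect φ (β * η) := hφ.defect_mono (by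
      rw [abs_mul]; exact le_mul_of_one_le_right (abs_nonneg β) h)
    have := pow_le_pow_left₀ (hφ.defect_nonneg β) h4 2
    have := min_le_right (Real.pi * sechDecay 1) (mollifierDefect φ β ^ 2)
    linarith

lemma normalSymbol_pos (φ : ℝ → ℂ) (β η : ℝ) : 0 < normalSymbol φ β η :=
  add_pos_of_pos_of_nonneg (mul_pos Real.pi_pos (sechDecay_pos η)) (sq_nonneg _)

lemma IsMollifier.continuous_normalSymbol (hφ : IsMollifier φ s) (β : ℝ) :
    Continuous (normalSymbol φ β) :=
  (continuous_const.mul continuous_sechDecay).add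
    ((hφ.continuous_defect.comp (continuous_const.mul continuous_id)).pow 2)

/-- The reciprocal of the symbol of the normal equation. -/
def IsMollifier.resolvent (hφ : IsMollifier φ s) {β : ℝ} (hβ : 0 < β) : ℝ →ᵇ ℂ :=
  realMultiplier (fun η => (normalSymbol φ β η)⁻¹)
    ((hφ.continuous_normalSymbol β).inv₀ fun η => (normalSymbol_pos φ β η).ne')
    (hφ.exists_le_normalSymbol hβ).choose⁻¹ fun η => by
      rw [abs_of_pos (inv_pos.2 (normalSymbol_pos φ β η))]
      exact inv_anti₀ (hφ.exists_le_normalSymbol hβ).choose_spec.1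
        ((hφ.exists_le_normalSymbol hβ).choose_spec.2 η)

/-- The solution of the normal equation for the data `g`. -/
def IsMollifier.normalSolution (hφ : IsMollifier φ s) {β : ℝ} (hβ : 0 < β) (g : L2Half) :
    L2Half :=
  fourierLog.symm (mulOp (hφ.resolvent hβ) (fourierLog (ContinuousLinearMap.adjoint laplace g)))

lemma IsMollifier.fourierLog_normalSolution (hφ : IsMollifier φ s) {β : ℝ} (hβ : 0 < β)
    (g : L2Half) :
    fourierLog (hφ.normalSolution hβ g) =ᵐ[volume] fun η => ((normalSymbol φ β η)⁻¹ : ℂ) *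
      fourierLog (ContinuousLinearMap.adjoint laplace g) η := by
  rw [IsMollifier.normalSolution, LinearIsometryEquiv.apply_symm_apply]
  filter_upwards [mulOp_coeFn (hφ.resolvent hβ)
    (fourierLog (ContinuousLinearMap.adjoint laplace g))] with η h
  rw [h, IsMollifier.resolvent, realMultiplier_apply, Complex.ofReal_inv]

lemma IsMollifier.star_defectMultiplier (hφ : IsMollifier φ s) (β : ℝ) :
    star (hφ.defectMultiplier β) = hφ.defectMultiplier β :=
  isSelfAdjoint_realMultiplier _ _ _ _

lemma IsMollifier.normal_equation (hφ : IsMollifier φ s) {β : ℝ} (hβ : 0 < β) (g : L2Half) :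
    fourierLog (ContinuousLinearMap.adjoint laplace (g - laplace (hφ.normalSolution hβ g))) =
      mulOp (hφ.defectMultiplier β) (mulOp (hφ.defectMultiplier β)
        (fourierLog (hφ.normalSolution hβ g))) := by
  set h := hφ.normalSolution hβ g with hh
  rw [map_sub, map_sub, fourierLog_adjoint_laplace]
  refine Lp.ext ?_
  filter_upwards [Lp.coeFn_sub (fourierLog (ContinuousLinearMap.adjoint laplace g))
      (mulOp (sechMultiplier Real.pi Real.pi_pos.le) (fourierLog h)),
    mulOp_coeFn (sechMultiplier Real.pi Real.pi_pos.le) (fourierLog h),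
    mulOp_coeFn (hφ.defectMultiplier β) (mulOp (hφ.defectMultiplier β) (fourierLog h)),
    mulOp_coeFn (hφ.defectMultiplier β) (fourierLog h),
    hφ.fourierLog_normalSolution hβ g] with η h1 h2 h3 h4 h5
  rw [h1, Pi.sub_apply, h2, h3, h4, h5, sechMultiplier_apply, IsMollifier.defectMultiplier,
    realMultiplier_apply]
  have hne : (normalSymbol φ β η : ℂ) ≠ 0 := by exact_mod_cast (normalSymbol_pos φ β η).ne'
  field_simp
  rw [normalSymbol]
  push_cast
  ring

/-- The regularization functional as a real number. -/
def IsMollifier.energy (hφ : IsMollifier φ s) (β : ℝ) (g f : L2Half) : ℝ :=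
  ‖g - laplace f‖ ^ 2 + ‖mulOp (hφ.defectMultiplier β) (fourierLog f)‖ ^ 2

lemma IsMollifier.objective_eq (hφ : IsMollifier φ s) {β : ℝ} (hβ : 0 < β) (g f : L2Half) :
    objective φ β g f = ENNReal.ofReal (hφ.energy β g f) := by
  rw [objective, hφ.enorm_defectMultiplier hβ, IsMollifier.energy,
    ENNReal.ofReal_add (by positivity) (by positivity), ENNReal.ofReal_pow (norm_nonneg _),
    ENNReal.ofReal_pow (norm_nonneg _), ofReal_norm, ofReal_norm]

/-- Completing the square: the two cross terms have opposite signs and cancel by the normal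
equation. -/
lemma IsMollifier.energy_eq (hφ : IsMollifier φ s) {β : ℝ} (hβ : 0 < β) (g f : L2Half) :
    hφ.energy β g f = hφ.energy β g (hφ.normalSolution hβ g) +
      (‖laplace (f - hφ.normalSolution hβ g)‖ ^ 2 +
        ‖mulOp (hφ.defectMultiplier β) (fourierLog (f - hφ.normalSolution hβ g))‖ ^ 2) := by
  set h := hφ.normalSolution hβ g with hh
  set d := f - h with hd
  set A := mulOp (hφ.defectMultiplier β) with hA
  have hf : f = h + d := by rw [hd, add_sub_cancel]
  have e1 : g - laplace f = (g - laplace h) - laplace d := by rw [hf, map_add]; abel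
  have e2 : A (fourierLog f) = A (fourierLog h) + A (fourierLog d) := by
    rw [hf, map_add, map_add]
  have hcross : inner ℂ (g - laplace h) (laplace d) =
      inner ℂ (A (fourierLog h)) (A (fourierLog d)) := by
    rw [← ContinuousLinearMap.adjoint_inner_left, ← fourierLog.inner_map_map,
      hφ.normal_equation hβ g]
    conv_lhs => rw [← hφ.star_defectMultiplier β, mulOp_star,
      ContinuousLinearMap.star_eq_adjoint, ContinuousLinearMap.adjoint_inner_left]
    rw [← ContinuousLinearMap.star_eq_adjoint, ← mulOp_star, hφ.star_defectMultiplier β]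
  rw [IsMollifier.energy, IsMollifier.energy, e1, e2, @norm_sub_sq ℂ, @norm_add_sq ℂ, hcross]
  ring

/-- The symbol of L*L vanishes nowhere. -/
lemma laplace_injective {d : L2Half} (h : laplace d = 0) : d = 0 := by
  have h1 := fourierLog_adjoint_laplace d
  rw [h, map_zero, map_zero] at h1
  apply fourierLog.injective
  rw [map_zero]
  refine Lp.ext ?_
  filter_upwards [mulOp_coeFn (sechMultiplier Real.pi Real.pi_pos.le) (fourierLog d),
    Lp.coeFn_zero ℂ 2 (volume : Measure ℝ)] with η h2 h3
  rw [← h1, h3, sechMultiplier_apply] at h2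
  rw [h3]
  refine (mul_eq_zero.1 h2.symm).resolve_left ?_
  exact_mod_cast (mul_pos Real.pi_pos (sechDecay_pos η)).ne'

/-- The functional has exactly one minimizer, the solution of the normal equation. -/
theorem IsMollifier.isRegularizedSolution_iff (hφ : IsMollifier φ s) {β : ℝ} (hβ : 0 < β)
    (g h : L2Half) : IsRegularizedSolution φ β g h ↔ h = hφ.normalSolution hβ g := by
  have hnn : ∀ f, 0 ≤ hφ.energy β g f := fun f => by unfold IsMollifier.energy; positivity
  constructor
  · intro hmin
    have h1 := hmin (hφ.normalSolution hβ g)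
    rw [hφ.objective_eq hβ, hφ.objective_eq hβ, ENNReal.ofReal_le_ofReal_iff (hnn _),
      hφ.energy_eq hβ g h] at h1
    have h2 : ‖laplace (h - hφ.normalSolution hβ g)‖ ^ 2 = 0 := by
      nlinarith [sq_nonneg ‖laplace (h - hφ.normalSolution hβ g)‖, sq_nonneg
        ‖mulOp (hφ.defectMultiplier β) (fourierLog (h - hφ.normalSolution hβ g))‖]
    exact sub_eq_zero.1 (laplace_injective (norm_eq_zero.1 (pow_eq_zero_iff two_ne_zero |>.1 h2)))
  · rintro rfl f
    rw [hφ.objective_eq hβ, hφ.objective_eq hβ, ENNReal.ofReal_le_ofReal_iff (hnn _),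
      hφ.energy_eq hβ g f]
    exact le_add_of_nonneg_right (by positivity)

/-! ### The error of the regularized solution -/

lemma norm_mulOp_apply_le {m : ℝ →ᵇ ℂ} {C : ℝ} (hC : 0 ≤ C) (hm : ∀ η, ‖m η‖ ≤ C) (v : L2Line) :
    ‖mulOp m v‖ ≤ C * ‖v‖ :=
  (mulOp m).le_of_opNorm_le ((norm_mulOp_le m).trans
    ((BoundedContinuousFunction.norm_le hC).2 hm)) v

lemma norm_laplace_sq (x : L2Half) :
    ‖laplace x‖ ^ 2 = RCLike.re (inner ℂ (fourierLog x)
      (mulOp (sechMultiplier Real.pi Real.pi_pos.le) (fourierLog x))) := by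
  rw [← fourierLog_adjoint_laplace, fourierLog.inner_map_map,
    ContinuousLinearMap.adjoint_inner_right, inner_self_eq_norm_sq]

/-- Propagation of data noise. -/
lemma IsMollifier.norm_normalSolution_le (hφ : IsMollifier φ s) {β : ℝ} (hβ : 0 < β) {S : ℝ}
    (hS : 0 ≤ S) (hbound : ∀ η, Real.pi * sechDecay η / normalSymbol φ β η ^ 2 ≤ S ^ 2)
    (e : L2Half) : ‖hφ.normalSolution hβ e‖ ≤ S * ‖e‖ := by
  set y := hφ.normalSolution hβ e with hy
  set R := mulOp (hφ.resolvent hβ) with hR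
  have hstar : star (hφ.resolvent hβ) = hφ.resolvent hβ := isSelfAdjoint_realMultiplier _ _ _ _
  -- Duality: with y = N⁻¹L*e and x = N⁻¹y one has ‖y‖² = ⟨Lx, e⟩, and ‖Lx‖² = ⟨y, (λ/N²) y⟩ is
  -- controlled by the hypothesis on the symbol. Only L*L is needed, not L itself.
  set x : L2Half := fourierLog.symm (R (fourierLog y)) with hx
  have hUx : fourierLog x = R (fourierLog y) := fourierLog.apply_symm_apply _
  have hadj : ∀ v w, inner ℂ (R v) w = inner ℂ v (R w) := fun v w => by
    conv_rhs => rw [hR, ← hstar, mulOp_star, ContinuousLinearMap.star_eq_adjoint,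
      ContinuousLinearMap.adjoint_inner_right]
  have h1 : inner ℂ y y = inner ℂ (laplace x) e := by
    rw [← ContinuousLinearMap.adjoint_inner_right, ← fourierLog.inner_map_map,
      ← fourierLog.inner_map_map, hUx, hadj]
    congr 1
    exact fourierLog.apply_symm_apply _
  have h2 : ‖laplace x‖ ^ 2 ≤ (S * ‖y‖) ^ 2 := by
    have hcomb : R (mulOp (sechMultiplier Real.pi Real.pi_pos.le) (R (fourierLog y))) =
        mulOp (hφ.resolvent hβ * (sechMultiplier Real.pi Real.pi_pos.le * hφ.resolvent hβ))
          (fourierLog y) := by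
      rw [mulOp_mul, mulOp_mul]; rfl
    rw [norm_laplace_sq, hUx, hadj, hcomb]
    refine (Complex.re_le_norm _).trans ((norm_inner_le_norm _ _).trans ?_)
    have h3 := norm_mulOp_apply_le (m := hφ.resolvent hβ *
      (sechMultiplier Real.pi Real.pi_pos.le * hφ.resolvent hβ)) (sq_nonneg S) (fun η => ?_)
      (fourierLog y)
    · rw [fourierLog.norm_map] at h3 ⊢
      nlinarith [norm_nonneg y]
    · refine le_trans (le_of_eq ?_) (hbound η)
      rw [BoundedContinuousFunction.mul_apply, BoundedContinuousFunction.mul_apply,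
        IsMollifier.resolvent, realMultiplier_apply, sechMultiplier_apply, ← Complex.ofReal_mul,
        ← Complex.ofReal_mul, Complex.norm_real, Real.norm_of_nonneg]
      · field_simp
      · have := normalSymbol_pos φ β η
        have := sechDecay_pos η
        positivity
  have h4 : ‖laplace x‖ ≤ S * ‖y‖ := (pow_le_pow_iff_left₀ (norm_nonneg _) (by positivity)
    two_ne_zero).1 h2
  have h5 : ‖y‖ ^ 2 ≤ S * ‖y‖ * ‖e‖ := by
    have h6 := congrArg norm h1
    rw [inner_self_eq_norm_sq_to_K, norm_pow, RCLike.norm_ofReal, abs_norm] at h6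
    rw [h6]
    exact (norm_inner_le_norm _ _).trans (by gcongr)
  rcases (norm_nonneg y).eq_or_lt with h0 | h0
  · rw [← h0]; positivity
  · nlinarith

/-- The bias of the method under a source condition. -/
lemma IsMollifier.norm_sub_normalSolution_le (hφ : IsMollifier φ s) {β : ℝ} (hβ : 0 < β)
    {ω : ℝ → ℝ} {B : ℝ} (hω : ∀ η, 0 ≤ ω η)
    (hbound : ∀ η, mollifierDefect φ (β * η) ^ 2 / normalSymbol φ β η * ω η ≤ B)
    {f w : L2Half} (hf : fourierLog f =ᵐ[volume] fun η => (ω η : ℂ) * fourierLog w η) :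
    ‖f - hφ.normalSolution hβ (laplace f)‖ ≤ B * ‖w‖ := by
  rw [← fourierLog.norm_map, ← fourierLog.norm_map w, map_sub]
  refine Lp.norm_le_mul_norm_of_ae_le_mul ?_
  filter_upwards [Lp.coeFn_sub (fourierLog f) (fourierLog (hφ.normalSolution hβ (laplace f))),
    hφ.fourierLog_normalSolution hβ (laplace f), hf,
    mulOp_coeFn (sechMultiplier Real.pi Real.pi_pos.le) (fourierLog f)] with η h1 h2 h3 h4
  rw [h1, Pi.sub_apply, h2, fourierLog_adjoint_laplace, h4, h3, sechMultiplier_apply]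
  have hpos := normalSymbol_pos φ β η
  have hne : (normalSymbol φ β η : ℂ) ≠ 0 := by exact_mod_cast hpos.ne'
  -- The residual factor is 1 - λ/N = a²/N.
  have e : (ω η : ℂ) * fourierLog w η - ((normalSymbol φ β η)⁻¹ : ℂ) *
      (((Real.pi * sechDecay η : ℝ) : ℂ) * ((ω η : ℂ) * fourierLog w η)) =
      ((mollifierDefect φ (β * η) ^ 2 / normalSymbol φ β η * ω η : ℝ) : ℂ) *
        fourierLog w η := by
    have e' : (mollifierDefect φ (β * η) : ℂ) ^ 2 =
        normalSymbol φ β η - ((Real.pi * sechDecay η : ℝ) : ℂ) := by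
      rw [normalSymbol]; push_cast; ring
    push_cast at e' ⊢
    rw [e']
    field_simp
  rw [e, norm_mul, Complex.norm_real, Real.norm_of_nonneg
    (mul_nonneg (div_nonneg (sq_nonneg _) hpos.le) (hω η))]
  gcongr
  exact hbound η

end Mollifier

/-! ### Asymptotics of the parameter choice -/

lemma tendsto_rpow_mul_neg_log_rpow {a q : ℝ} (ha : 0 < a) :
    Tendsto (fun δ : ℝ => δ ^ a * (-Real.log δ) ^ q) (𝓝[>] 0) (𝓝 0) := by
  have h := (isLittleO_abs_log_rpow_rpow_nhdsGT_zero q (neg_lt_zero.2 ha)).tendsto_div_nhds_zero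
  refine h.congr' ?_
  filter_upwards [Ioo_mem_nhdsGT (zero_lt_one' ℝ)] with δ hδ
  rw [abs_of_neg (Real.log_neg hδ.1 hδ.2), Real.rpow_neg hδ.1.le, div_inv_eq_mul, mul_comm]

lemma logSource_rpow {p a δ : ℝ} (ha : 0 < a) (hδ : 0 < δ) (hδ1 : δ < 1) :
    logSource p (δ ^ a) = a ^ (-p) * (-Real.log δ) ^ (-p) := by
  have := Real.log_neg hδ hδ1
  rw [logSource, Real.log_rpow hδ, ← mul_neg, Real.mul_rpow ha.le (by linarith)]

section Rates

variable {φ : ℝ → ℂ} {s c θ : ℝ}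

/-- The amplification of the noise for `β(δ) = c δ^{θ/s}` is of order `δ^{-θ}`. -/
lemma IsMollifier.exists_noise_bound (hφ : IsMollifier φ s) (hs : 0 < s) (hc : 0 < c)
    (hθ : 0 < θ) :
    ∃ C > 0, ∀ᶠ δ : ℝ in 𝓝[>] 0, ∀ η,
      Real.pi * sechDecay η / normalSymbol φ (c * δ ^ (θ / s)) η ^ 2 ≤ (C * δ ^ (-θ)) ^ 2 := by
  obtain ⟨r, hr, hbd⟩ := hφ.exists_defect_bounds hs
  set D := (Real.pi * sechDecay 1)⁻¹ with hD
  have hDpos : 0 < D := inv_pos.2 (mul_pos Real.pi_pos (sechDecay_pos 1))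
  set E := 2 * ((2 * Real.pi * c) ^ s)⁻¹ with hE
  have hEpos : 0 < E := by positivity
  -- D serves |η| ≤ 1 and E serves |η| ≥ 1; the summand 1 ensures D ≤ (D + 1 + E)².
  refine ⟨D + 1 + E, by positivity, ?_⟩
  have hlim : Tendsto (fun δ : ℝ => c * δ ^ (θ / s)) (𝓝[>] 0) (𝓝 0) := by
    have h := (tendsto_rpow_mul_neg_log_rpow (q := 0) (div_pos hθ hs)).const_mul c
    simpa using h
  filter_upwards [Ioo_mem_nhdsGT (zero_lt_one' ℝ), hlim.eventually (gt_mem_nhds hr)]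
    with δ hδ hδr η
  set β := c * δ ^ (θ / s) with hβ
  have hβpos : 0 < β := mul_pos hc (Real.rpow_pos_of_pos hδ.1 _)
  have hN := normalSymbol_pos φ β η
  have hl : 0 < Real.pi * sechDecay η := mul_pos Real.pi_pos (sechDecay_pos η)
  have hδθ : 0 < δ ^ (-θ) := Real.rpow_pos_of_pos hδ.1 _
  have hδ1 : 1 ≤ δ ^ (-θ) :=
    Real.one_le_rpow_of_pos_of_le_one_of_nonpos hδ.1 hδ.2.le (by linarith)
  have ha := sq_nonneg (mollifierDefect φ (β * η))
  rw [mul_pow]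
  rcases le_total |η| 1 with h | h
  · have h1 : sechDecay 1 ≤ sechDecay η := sechDecay_anti (by simpa using h)
    calc Real.pi * sechDecay η / normalSymbol φ β η ^ 2
        ≤ Real.pi * sechDecay η / (Real.pi * sechDecay η) ^ 2 := by
          gcongr
          exact le_add_of_nonneg_right ha
      _ = (Real.pi * sechDecay η)⁻¹ := by field_simp
      _ ≤ D := inv_anti₀ (mul_pos Real.pi_pos (sechDecay_pos 1)) (by gcongr)
      _ ≤ (D + 1 + E) ^ 2 * 1 := by nlinarith
      _ ≤ _ := by gcongr; exact one_le_pow₀ hδ1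
  · have h4 : mollifierDefect φ β ≤ mollifierDefect φ (β * η) := hφ.defect_mono (by
      rw [abs_mul β]; exact le_mul_of_one_le_right (abs_nonneg β) h)
    have h5 := (hbd β (by rw [abs_of_pos hβpos]; exact hδr.le)).1
    -- The exponent θ/s in the parameter choice makes β^s a multiple of δ^θ.
    have h6 : 1 / 2 * |2 * Real.pi * β| ^ s = (E * δ ^ (-θ))⁻¹ := by
      have e : 2 * Real.pi * β = (2 * Real.pi * c) * δ ^ (θ / s) := by rw [hβ]; ring
      rw [abs_of_pos (by positivity), e, Real.mul_rpow (by positivity)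
        (Real.rpow_nonneg hδ.1.le _), ← Real.rpow_mul hδ.1.le, div_mul_cancel₀ _ hs.ne', hE,
        Real.rpow_neg hδ.1.le]
      field_simp
    rw [h6] at h5
    have h7 : (E * δ ^ (-θ))⁻¹ ^ 2 ≤ mollifierDefect φ (β * η) ^ 2 := by
      gcongr
      exact h5.trans h4
    -- From (λ + a²)² ≥ λa² one gets λ/N² ≤ 1/a².
    have h8 : Real.pi * sechDecay η * mollifierDefect φ (β * η) ^ 2 ≤ normalSymbol φ β η ^ 2 := by
      unfold normalSymbol
      nlinarith
    calc Real.pi * sechDecay η / normalSymbol φ β η ^ 2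
        ≤ (E * δ ^ (-θ)) ^ 2 := by
          rw [div_le_iff₀ (by positivity)]
          have h9 := h7.trans' (le_of_eq (inv_pow _ 2).symm)
          rw [inv_le_iff_one_le_mul₀ (by positivity)] at h9
          calc Real.pi * sechDecay η ≤ Real.pi * sechDecay η *
                (mollifierDefect φ (β * η) ^ 2 * (E * δ ^ (-θ)) ^ 2) :=
                le_mul_of_one_le_right hl.le h9
            _ = (E * δ ^ (-θ)) ^ 2 *
                (Real.pi * sechDecay η * mollifierDefect φ (β * η) ^ 2) := by ring
            _ ≤ _ := by gcongr
      _ = E ^ 2 * (δ ^ (-θ)) ^ 2 := mul_pow _ _ _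
      _ ≤ _ := by gcongr; linarith

/-- Under the logarithmic source condition the bias is of order `f_p(δ^{2θ})`. -/
lemma IsMollifier.exists_bias_bound (hφ : IsMollifier φ s) (hs : 0 < s) (hc : 0 < c)
    (hθ : 0 < θ) {p : ℝ} (hp : 0 < p) :
    ∃ K > 0, ∀ᶠ δ : ℝ in 𝓝[>] 0, ∀ η,
      mollifierDefect φ (c * δ ^ (θ / s) * η) ^ 2 / normalSymbol φ (c * δ ^ (θ / s)) η *
        logWeight η ^ (-p) ≤ K * logSource p (δ ^ (2 * θ)) := by
  obtain ⟨r, hr, hbd⟩ := hφ.exists_defect_bounds hs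
  -- With this κ the cut |η| = κ ln(1/δ) is where e^{2π²|η|} = δ^{-θ}.
  set κ := θ / (2 * Real.pi ^ 2) with hκ
  have hκpos : 0 < κ := by positivity
  set A := (2 * (2 * Real.pi * (c * κ)) ^ s) ^ 2 with hA
  have hApos : 0 < A := by positivity
  -- With l = ln(1/δ), f_p(δ^{2θ}) = (2θl)^{-p}; the two summands produce A l^{-p} below the cut and
  -- (θl)^{-p} above it.
  refine ⟨A * (2 * θ) ^ p + 2 ^ p, by positivity, ?_⟩
  have hlim1 : Tendsto (fun δ : ℝ => c * κ * (δ ^ (θ / s) * (-Real.log δ) ^ (1 : ℝ)))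
      (𝓝[>] 0) (𝓝 0) := by
    simpa using (tendsto_rpow_mul_neg_log_rpow (q := 1) (div_pos hθ hs)).const_mul (c * κ)
  -- Below the cut a²/N is at most A δ^θ l^{2s}; the extra exponent p is what allows comparison with
  -- l^{-p}.
  have hlim2 := tendsto_rpow_mul_neg_log_rpow (a := θ) (q := 2 * s + p) hθ
  filter_upwards [Ioo_mem_nhdsGT (zero_lt_one' ℝ), hlim1.eventually (gt_mem_nhds hr),
    hlim2.eventually (gt_mem_nhds one_pos)] with δ hδ hδr hδ1 η
  rw [Real.rpow_one] at hδr
  set β := c * δ ^ (θ / s) with hβ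
  set l := -Real.log δ with hl
  have hlpos : 0 < l := neg_pos.2 (Real.log_neg hδ.1 hδ.2)
  have hβpos : 0 < β := mul_pos hc (Real.rpow_pos_of_pos hδ.1 _)
  have hN := normalSymbol_pos φ β η
  have hsd : 0 < Real.pi * sechDecay η := mul_pos Real.pi_pos (sechDecay_pos η)
  have hW := logWeight_pos η
  have hlp : 0 < l ^ (-p) := Real.rpow_pos_of_pos hlpos _
  have hsrc : (A * (2 * θ) ^ p + 2 ^ p) * logSource p (δ ^ (2 * θ)) =
      A * l ^ (-p) + (θ * l) ^ (-p) := by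
    rw [logSource_rpow (by positivity) hδ.1 hδ.2, Real.mul_rpow two_pos.le hθ.le,
      Real.mul_rpow two_pos.le hθ.le, Real.mul_rpow hθ.le hlpos.le, ← hl,
      Real.rpow_neg two_pos.le, Real.rpow_neg hθ.le]
    field_simp
  rw [hsrc]
  rcases le_total |η| (κ * l) with h | h
  -- Even at the cut βη tends to 0 with δ, so the power bound on the defect applies to all these
  -- frequencies.
  · have h1 : |β * η| ≤ r := by
      rw [abs_mul, abs_of_pos hβpos]
      calc β * |η| ≤ β * (κ * l) := by gcongr
        _ = c * κ * (δ ^ (θ / s) * l) := by rw [hβ]; ring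
        _ ≤ r := hδr.le
    have h2 : mollifierDefect φ (β * η) ^ 2 ≤ A * (δ ^ θ * δ ^ θ) * l ^ (2 * s) := by
      have h3 : mollifierDefect φ (β * η) ≤
          2 * (2 * Real.pi * (c * κ)) ^ s * (δ ^ θ * l ^ s) := by
        refine (hbd _ h1).2.trans ?_
        have e : |2 * Real.pi * (β * η)| ≤ 2 * Real.pi * (c * κ) * (δ ^ (θ / s) * l) := by
          rw [abs_mul (2 * Real.pi), abs_mul β, abs_of_pos Real.two_pi_pos, abs_of_pos hβpos]
          calc 2 * Real.pi * (β * |η|) ≤ 2 * Real.pi * (β * (κ * l)) := by gcongr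
            _ = _ := by rw [hβ]; ring
        have hδs := Real.rpow_nonneg hδ.1.le (θ / s)
        calc 2 * |2 * Real.pi * (β * η)| ^ s
            ≤ 2 * (2 * Real.pi * (c * κ) * (δ ^ (θ / s) * l)) ^ s := by gcongr
          _ = _ := by
            rw [Real.mul_rpow (by positivity) (by positivity), Real.mul_rpow hδs hlpos.le,
              ← Real.rpow_mul hδ.1.le, div_mul_cancel₀ _ hs.ne']; ring
      calc mollifierDefect φ (β * η) ^ 2
          ≤ (2 * (2 * Real.pi * (c * κ)) ^ s * (δ ^ θ * l ^ s)) ^ 2 :=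
            pow_le_pow_left₀ (hφ.defect_nonneg _) h3 2
        _ = _ := by
          rw [mul_comm 2 s, Real.rpow_mul hlpos.le, Real.rpow_two, hA]; ring
    have h4 : (Real.pi * sechDecay η)⁻¹ ≤ (δ ^ θ)⁻¹ := by
      rw [sechDecay, mul_inv, inv_inv]
      have h5 : Real.cosh (2 * Real.pi ^ 2 * η) ≤ (δ ^ θ)⁻¹ := by
        refine (cosh_le_exp_abs _).trans ?_
        rw [← Real.rpow_neg hδ.1.le, Real.rpow_def_of_pos hδ.1, abs_mul,
          abs_of_pos (by positivity : 0 < 2 * Real.pi ^ 2)]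
        refine Real.exp_le_exp.2 ?_
        calc 2 * Real.pi ^ 2 * |η| ≤ 2 * Real.pi ^ 2 * (κ * l) := by gcongr
          _ = Real.log δ * -θ := by rw [hκ, hl]; field_simp
      refine le_trans ?_ h5
      exact mul_le_of_le_one_left (Real.cosh_pos _).le
        (inv_le_one_of_one_le₀ (by linarith [Real.pi_gt_three]))
    have hδθ : 0 < δ ^ θ := Real.rpow_pos_of_pos hδ.1 _
    have h6 : mollifierDefect φ (β * η) ^ 2 / normalSymbol φ β η ≤ A * l ^ (-p) := by
      calc mollifierDefect φ (β * η) ^ 2 / normalSymbol φ β η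
          ≤ mollifierDefect φ (β * η) ^ 2 / (Real.pi * sechDecay η) := by
            gcongr
            exact le_add_of_nonneg_right (sq_nonneg _)
        _ ≤ A * (δ ^ θ * δ ^ θ) * l ^ (2 * s) * (δ ^ θ)⁻¹ := by
            rw [div_eq_mul_inv]
            gcongr
        _ = A * ((δ ^ θ * l ^ (2 * s + p)) * l ^ (-p)) := by
            rw [Real.rpow_add hlpos, Real.rpow_neg hlpos.le]
            have := Real.rpow_pos_of_pos hlpos p
            field_simp
        _ ≤ A * (1 * l ^ (-p)) := by gcongr
        _ = A * l ^ (-p) := by rw [one_mul]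
    have h7 : logWeight η ^ (-p) ≤ 1 :=
      Real.rpow_le_one_of_one_le_of_nonpos (one_le_logWeight η) (by linarith)
    calc _ ≤ A * l ^ (-p) * 1 := by gcongr
      _ ≤ _ := by rw [mul_one]; exact le_add_of_nonneg_right (by positivity)
  · have h1 : θ * l ≤ logWeight η := by
      refine le_trans ?_ (le_logWeight η)
      calc θ * l = 2 * Real.pi ^ 2 * (κ * l) := by rw [hκ]; field_simp
        _ ≤ _ := by gcongr
    have h2 : logWeight η ^ (-p) ≤ (θ * l) ^ (-p) :=
      Real.rpow_le_rpow_of_nonpos (by positivity) h1 (by linarith)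
    have h3 : mollifierDefect φ (β * η) ^ 2 / normalSymbol φ β η ≤ 1 := by
      rw [div_le_one hN]
      exact le_add_of_nonneg_left hsd.le
    calc _ ≤ 1 * (θ * l) ^ (-p) := by gcongr
      _ ≤ _ := by rw [one_mul]; exact le_add_of_nonneg_left (by positivity)

end Rates

/-- For 0 < δ < 1, f_p(δ^{2θ}) is a constant multiple of f_p(δ²), and the power δ^{1-θ} is
negligible against any power of the logarithm. -/
lemma isBigO_errorBound {p θ : ℝ} (K C ρ : ℝ) (hθ0 : 0 < θ) (hθ1 : θ < 1) :
    Asymptotics.IsBigO (𝓝[>] 0) (errorBound p θ K C ρ fun _ => 0)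
      (fun δ : ℝ => logSource p (δ ^ 2)) := by
  have hsq : (fun δ : ℝ => logSource p (δ ^ 2)) =ᶠ[𝓝[>] 0]
      fun δ => 2 ^ (-p) * (-Real.log δ) ^ (-p) := by
    filter_upwards [Ioo_mem_nhdsGT (zero_lt_one' ℝ)] with δ hδ
    rw [← Real.rpow_two, logSource_rpow two_pos hδ.1 hδ.2]
  have h2 : (2 : ℝ) ^ (-p) ≠ 0 := (Real.rpow_pos_of_pos two_pos _).ne'
  refine Asymptotics.IsBigO.trans_eventuallyEq ?_ hsq.symm
  refine Asymptotics.IsBigO.const_mul_right h2 ?_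
  unfold errorBound
  refine Asymptotics.IsBigO.add ?_ (Asymptotics.IsBigO.const_mul_left ?_ C)
  · refine Asymptotics.IsBigO.congr' (f₁ := fun δ : ℝ =>
      (K * ρ * (2 * θ) ^ (-p)) * (-Real.log δ) ^ (-p))
      ((Asymptotics.isBigO_refl _ _).const_mul_left _) ?_ EventuallyEq.rfl
    filter_upwards [Ioo_mem_nhdsGT (zero_lt_one' ℝ)] with δ hδ
    rw [logSource_rpow (by positivity) hδ.1 hδ.2]
    ring
  · refine Asymptotics.IsLittleO.isBigO ?_
    have hne : ∀ᶠ δ : ℝ in 𝓝[>] 0, (-Real.log δ) ^ (-p) ≠ 0 := by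
      filter_upwards [Ioo_mem_nhdsGT (zero_lt_one' ℝ)] with δ hδ
      exact (Real.rpow_pos_of_pos (neg_pos.2 (Real.log_neg hδ.1 hδ.2)) _).ne'
    rw [Asymptotics.isLittleO_iff_tendsto' (hne.mono fun δ h h0 => absurd h0 h)]
    refine (tendsto_rpow_mul_neg_log_rpow (q := p) (sub_pos.2 hθ1)).congr' ?_
    filter_upwards [Ioo_mem_nhdsGT (zero_lt_one' ℝ)] with δ hδ
    rw [Real.rpow_neg (neg_pos.2 (Real.log_neg hδ.1 hδ.2)).le, div_inv_eq_mul]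

end LaplaceMollification

end

/-! ### The convergence rate -/

theorem mainTheorem3 (φ : ℝ → ℂ) (s : ℝ) (hs : 0 < s)
    (hφ : LaplaceMollification.IsMollifier φ s)
    (c θ : ℝ) (hc : 0 < c) (hθ0 : 0 < θ) (hθ1 : θ < 1) :
    (∀ (β : ℝ) (g : LaplaceMollification.L2Half), 0 < β →
      ∃! h : LaplaceMollification.L2Half,
        LaplaceMollification.IsRegularizedSolution φ β g h) ∧
    ∃ C : ℝ, 0 < C ∧ ∀ p : ℝ, 0 < p → ∃ K m M : ℝ, 0 < K ∧ 0 < m ∧ 0 < M ∧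
      ∀ f g : LaplaceMollification.L2Half, LaplaceMollification.laplace f = g →
        LaplaceMollification.MemHp p (LaplaceMollification.logChange f) →
        ∃ w : LaplaceMollification.L2Half,
          (∀ w' : LaplaceMollification.L2Half,
            LaplaceMollification.sourceOperator p w' = f ↔ w' = w) ∧
          ENNReal.ofReal (m * ‖w‖) ≤
            LaplaceMollification.sobolevNorm p (LaplaceMollification.logChange f) ∧
          LaplaceMollification.sobolevNorm p (LaplaceMollification.logChange f) ≤
            ENNReal.ofReal (M * ‖w‖) ∧
          ∃ ε : ℝ → ℝ, Tendsto ε (𝓝[>] 0) (𝓝 0) ∧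
            (∀ᶠ δ : ℝ in 𝓝[>] 0, ∀ gδ h : LaplaceMollification.L2Half, ‖g - gδ‖ ≤ δ →
              LaplaceMollification.IsRegularizedSolution φ (c * δ ^ (θ / s)) gδ h →
              ‖f - h‖ ≤ LaplaceMollification.errorBound p θ K C ‖w‖ ε δ) ∧
            Asymptotics.IsBigO (𝓝[>] 0)
              (LaplaceMollification.errorBound p θ K C ‖w‖ ε)
              (fun δ : ℝ => LaplaceMollification.logSource p (δ ^ 2)) := by
  open LaplaceMollification in
  refine ⟨fun β g hβ => ⟨hφ.normalSolution hβ g, (hφ.isRegularizedSolution_iff hβ g _).2 rfl,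
    fun h hh => (hφ.isRegularizedSolution_iff hβ g h).1 hh⟩, ?_⟩
  obtain ⟨C, hC, hnoise⟩ := hφ.exists_noise_bound hs hc hθ0
  refine ⟨C, hC, fun p hp => ?_⟩
  obtain ⟨K, hK, hbias⟩ := hφ.exists_bias_bound hs hc hθ0 hp
  refine ⟨K, ((2 * Real.pi) ^ p)⁻¹, 2 ^ p, hK, by positivity, by positivity, ?_⟩
  rintro f g rfl hf
  obtain ⟨w, hw, hm, hM, hsrc⟩ := LaplaceMollification.exists_source_of_memHp hp hf
  -- The bias bound already holds for all small δ with the fixed constant K, so the o(1) term can be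
  -- zero.
  refine ⟨w, hw, hm, hM, fun _ => 0, tendsto_const_nhds, ?_,
    LaplaceMollification.isBigO_errorBound K C ‖w‖ hθ0 hθ1⟩
  filter_upwards [hnoise, hbias, self_mem_nhdsWithin] with δ h1 h2 hδ gδ h hg hh
  have hδ : 0 < δ := hδ
  have hβ : 0 < c * δ ^ (θ / s) := mul_pos hc (Real.rpow_pos_of_pos hδ _)
  rw [hφ.isRegularizedSolution_iff hβ] at hh
  -- The regularized solution is linear in the data, so the error separates into the bias for exact
  -- data and the response to the noise.
  have hsub : hφ.normalSolution hβ (LaplaceMollification.laplace f) - h =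
      hφ.normalSolution hβ (LaplaceMollification.laplace f - gδ) := by
    rw [hh]
    simp only [LaplaceMollification.IsMollifier.normalSolution, map_sub]
  have hb := hφ.norm_sub_normalSolution_le hβ
    (fun η => Real.rpow_nonneg (LaplaceMollification.logWeight_pos η).le (-p)) h2 hsrc
  have hn := hφ.norm_normalSolution_le hβ (by positivity) h1 (LaplaceMollification.laplace f - gδ)
  calc ‖f - h‖ = ‖(f - hφ.normalSolution hβ (LaplaceMollification.laplace f)) +
        hφ.normalSolution hβ (LaplaceMollification.laplace f - gδ)‖ := by
        rw [← hsub, sub_add_sub_cancel]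
    _ ≤ K * LaplaceMollification.logSource p (δ ^ (2 * θ)) * ‖w‖ + C * δ ^ (-θ) * δ := by
        refine (norm_add_le _ _).trans (add_le_add hb (hn.trans ?_))
        gcongr
    _ = _ := by
        have e : δ ^ (1 - θ) = δ ^ (-θ) * δ := by
          rw [sub_eq_neg_add, Real.rpow_add hδ, Real.rpow_one]
        rw [LaplaceMollification.errorBound, e]
        ring
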